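/- Let $\Bbbk$ be a field and $f:C\to D$ a morphism of (coassociative, counital) $\Bbbk$-coalgebras. Write $\mathcal M^C$, ${}^C\mathcal M$, ${}^C\mathcal M^C$ for the categories of right comodules, left comodules and bicomodules over $C$, and $V\square_D W\subseteq V\otimes W$ for the cotensor product, i.e. the equalizer of $\rho_V\otimes\mathrm{id}$ and $\mathrm{id}\otimes\lambda_W$ for a right $D$-coaction $\rho_V$ and a left $D$-coaction $\lambda_W$. Through $f$, $C$ is a $D$-bicomodule and every $C$-comodule is a $D$-comodule. The cotensor product $C\square_D C$ is a unital algebra in the monoidal category $({}^C\mathcal M^C,\square_C,C)$, with multiplication $$(C\square_DC)\square_C(C\square_DC)\cong C\square_DC\square_DC\xrightarrow{\ \mathrm{id}\otimes\varepsilon_C\otimes\mathrm{id}\ }C\square_DC$$ and unit $\Delta_C:C\to C\square_DC$. Let $\mathcal M_{C\square_DC}$ be the category of right $C\square_DC$-modules: right $C$-comodules $N$ with an associative and unital action $N\square_C(C\square_DC)\to N$ in $\mathcal M^C$. For $W\in\mathcal M^D$, the right $C$-comodule $W\square_DC$ is such a module through $$(W\square_DC)\square_C(C\square_DC)\cong W\square_DC\square_DC\xrightarrow{\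 \mathrm{id}\otimes\varepsilon_C\otimes\mathrm{id}\ }W\square_DC .$$ The resulting functor $-\square_DC:\mathcal M^D\to\mathcal M_{C\square_DC}$ has as left adjoint the functor of coinvariants $N\mapsto N_{C\square_DC}$, where $N_{C\square_DC}$ is the coequalizer in vector spaces, with the induced right $D$-coaction, of the two maps $N\square_DC\to N$ given by the action (along $N\square_DC\cong N\square_C(C\square_DC)$) and by $\mathrm{id}\otimes\varepsilon_C$. The unit of the adjunction is $N\to N_{C\square_DC}\square_DC$, $n\mapsto [n_0]\otimes n_1$, and its counit is $(W\square_DC)_{C\square_DC}\to W$, $[w\otimes c]\mapsto \varepsilon_C(c)w$. **Theorem.** This adjunction is an equivalence of categories (its unit and its counit are isomorphisms) if at least one of the following holds: - $f$ is left faithfully coflat: the functor $-\square_DC:\mathcal M^D\to\mathrm{Vec}_{\Bbbk}$ is exact and faithful; - $f$ has a right inverse in the category ${}^D\mathcal M^D$ of $D$-bicomodules. -/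

import Mathlib

open TensorProduct CategoryTheory

universe u v

namespace CoalgDescent

noncomputable section

section Raw

variable {k : Type u} [Field k]
variable {C D E : Type v} [AddCommGroup C] [Module k C] [AddCommGroup D] [Module k D]
  [AddCommGroup E] [Module k E]
variable {U V V' W W' X Y Z : Type v} [AddCommGroup U] [Module k U] [AddCommGroup V] [Module k V]
  [AddCommGroup V'] [Module k V'] [AddCommGroup W] [Module k W] [AddCommGroup W'] [Module k W']
  [AddCommGroup X] [Module k X] [AddCommGroup Y] [Module k Y] [AddCommGroup Z] [Module k Z]

/-- Over a field, `Z ⊗ eq(a, b)` is the equalizer of `Z ⊗ a` and `Z ⊗ b`: a linear map into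
`Z ⊗ X` equalizing the latter factors through `Z ⊗ eq(a, b)`. -/
def liftL (a b : X →ₗ[k] Y) (t : U →ₗ[k] Z ⊗[k] X)
    (h : ∀ x, a.lTensor Z (t x) = b.lTensor Z (t x)) :
    U →ₗ[k] Z ⊗[k] (LinearMap.eqLocus a b) :=
  LinearMap.codRestrictOfInjective t ((LinearMap.eqLocus a b).subtype.lTensor Z)
    (Module.Flat.lTensor_preserves_injective_linearMap _ (Submodule.injective_subtype _))
    (fun x => by
      have := Module.Flat.eqLocus_lTensor_eq k Z a b
      change _ = LinearMap.range ((LinearMap.eqLocus a b).subtype.lTensor Z) at this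
      rw [← this]
      exact h x)

theorem liftL_spec (a b : X →ₗ[k] Y) (t : U →ₗ[k] Z ⊗[k] X)
    (h : ∀ x, a.lTensor Z (t x) = b.lTensor Z (t x)) (x : U) :
    (LinearMap.eqLocus a b).subtype.lTensor Z (liftL a b t h x) = t x :=
  LinearMap.codRestrictOfInjective_comp_apply t ((LinearMap.eqLocus a b).subtype.lTensor Z) _ _ x

/-- The mirror image of `liftL`. -/
def liftR (a b : X →ₗ[k] Y) (t : U →ₗ[k] X ⊗[k] Z)
    (h : ∀ x, a.rTensor Z (t x) = b.rTensor Z (t x)) :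
    U →ₗ[k] (LinearMap.eqLocus a b) ⊗[k] Z :=
  LinearMap.codRestrictOfInjective t ((LinearMap.eqLocus a b).subtype.rTensor Z)
    (Module.Flat.rTensor_preserves_injective_linearMap _ (Submodule.injective_subtype _))
    (fun x => by
      have h1 : ∀ s : Z ⊗[k] (LinearMap.eqLocus a b),
          (LinearMap.eqLocus a b).subtype.rTensor Z (TensorProduct.comm k _ _ s) =
            TensorProduct.comm k _ _ ((LinearMap.eqLocus a b).subtype.lTensor Z s) := fun s => by
        simp [LinearMap.rTensor, LinearMap.lTensor, TensorProduct.map_comm]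
      have h2 : ∀ (c : X →ₗ[k] Y) (s : X ⊗[k] Z),
          c.lTensor Z (TensorProduct.comm k _ _ s) =
            TensorProduct.comm k _ _ (c.rTensor Z s) := fun c s => by
        simp [LinearMap.rTensor, LinearMap.lTensor, TensorProduct.map_comm]
      refine ⟨TensorProduct.comm k _ _ (liftL a b
        ((TensorProduct.comm k X Z).toLinearMap ∘ₗ t) (fun y => ?_) x), ?_⟩
      · simp only [LinearMap.comp_apply, LinearEquiv.coe_coe, h2, h]
      · rw [h1, liftL_spec]
        simp)

theorem liftR_spec (a b : X →ₗ[k] Y) (t : U →ₗ[k] X ⊗[k] Z)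
    (h : ∀ x, a.rTensor Z (t x) = b.rTensor Z (t x)) (x : U) :
    (LinearMap.eqLocus a b).subtype.rTensor Z (liftR a b t h x) = t x :=
  LinearMap.codRestrictOfInjective_comp_apply t ((LinearMap.eqLocus a b).subtype.rTensor Z) _ _ x

/-- The cotensor product `V □_D W` of a right coaction `ρ : V → V ⊗ D` and a left coaction
`l : W → D ⊗ W`: the equalizer of `ρ ⊗ W` and `V ⊗ l`, as a subspace of `V ⊗ W`. -/
def cotensor (ρ : V →ₗ[k] V ⊗[k] D) (l : W →ₗ[k] D ⊗[k] W) : Submodule k (V ⊗[k] W) :=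
  LinearMap.eqLocus ((TensorProduct.assoc k V D W).toLinearMap ∘ₗ ρ.rTensor W) (l.lTensor V)

/-- The cotensor product `V □_D W` as a vector space. -/
def Cotensor (ρ : V →ₗ[k] V ⊗[k] D) (l : W →ₗ[k] D ⊗[k] W) : Type v := ↥(cotensor ρ l)

instance (ρ : V →ₗ[k] V ⊗[k] D) (l : W →ₗ[k] D ⊗[k] W) : AddCommGroup (Cotensor ρ l) :=
  inferInstanceAs (AddCommGroup ↥(cotensor ρ l))

instance (ρ : V →ₗ[k] V ⊗[k] D) (l : W →ₗ[k] D ⊗[k] W) : Module k (Cotensor ρ l) :=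
  inferInstanceAs (Module k ↥(cotensor ρ l))

/-- The inclusion `V □_D W ⊆ V ⊗ W`. -/
def incl (ρ : V →ₗ[k] V ⊗[k] D) (l : W →ₗ[k] D ⊗[k] W) : Cotensor ρ l →ₗ[k] V ⊗[k] W :=
  (cotensor ρ l).subtype

theorem incl_injective (ρ : V →ₗ[k] V ⊗[k] D) (l : W →ₗ[k] D ⊗[k] W) :
    Function.Injective (incl ρ l) :=
  Submodule.injective_subtype _

theorem incl_cond (ρ : V →ₗ[k] V ⊗[k] D) (l : W →ₗ[k] D ⊗[k] W) (x : Cotensor ρ l) :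
    TensorProduct.assoc k V D W (ρ.rTensor W (incl ρ l x)) = l.lTensor V (incl ρ l x) :=
  x.2

/-- A linear map into `V ⊗ W` with values in `V □_D W`, as a map into `V □_D W`. -/
def intoCot (ρ : V →ₗ[k] V ⊗[k] D) (l : W →ₗ[k] D ⊗[k] W) (t : U →ₗ[k] V ⊗[k] W)
    (h : ∀ x, TensorProduct.assoc k V D W (ρ.rTensor W (t x)) = l.lTensor V (t x)) :
    U →ₗ[k] Cotensor ρ l :=
  LinearMap.codRestrict (cotensor ρ l) t h

@[simp]
theorem incl_intoCot (ρ : V →ₗ[k] V ⊗[k] D) (l : W →ₗ[k] D ⊗[k] W) (t : U →ₗ[k] V ⊗[k] W)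
    (h : ∀ x, TensorProduct.assoc k V D W (ρ.rTensor W (t x)) = l.lTensor V (t x)) (x : U) :
    incl ρ l (intoCot ρ l t h x) = t x := rfl

theorem rTensor_inj {Z : Type*} [AddCommGroup Z] [Module k Z] (g : X →ₗ[k] Y)
    (hg : Function.Injective g) : Function.Injective (g.rTensor Z) :=
  Module.Flat.rTensor_preserves_injective_linearMap _ hg

theorem lTensor_inj {Z : Type*} [AddCommGroup Z] [Module k Z] (g : X →ₗ[k] Y)
    (hg : Function.Injective g) : Function.Injective (g.lTensor Z) :=
  Module.Flat.lTensor_preserves_injective_linearMap _ hg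

/-- A linear map into `Z ⊗ (V ⊗ W)` with values in `Z ⊗ (V □_D W)`. -/
def intoCotL (ρ : V →ₗ[k] V ⊗[k] D) (l : W →ₗ[k] D ⊗[k] W) (t : U →ₗ[k] Z ⊗[k] (V ⊗[k] W))
    (h : ∀ x, ((TensorProduct.assoc k V D W).toLinearMap ∘ₗ ρ.rTensor W).lTensor Z (t x) =
      (l.lTensor V).lTensor Z (t x)) :
    U →ₗ[k] Z ⊗[k] Cotensor ρ l :=
  liftL _ _ t h

theorem intoCotL_spec (ρ : V →ₗ[k] V ⊗[k] D) (l : W →ₗ[k] D ⊗[k] W)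
    (t : U →ₗ[k] Z ⊗[k] (V ⊗[k] W))
    (h : ∀ x, ((TensorProduct.assoc k V D W).toLinearMap ∘ₗ ρ.rTensor W).lTensor Z (t x) =
      (l.lTensor V).lTensor Z (t x)) (x : U) :
    (incl ρ l).lTensor Z (intoCotL ρ l t h x) = t x :=
  liftL_spec _ _ t h x

/-- A linear map into `(V ⊗ W) ⊗ Z` with values in `(V □_D W) ⊗ Z`. -/
def intoCotR (ρ : V →ₗ[k] V ⊗[k] D) (l : W →ₗ[k] D ⊗[k] W) (t : U →ₗ[k] (V ⊗[k] W) ⊗[k] Z)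
    (h : ∀ x, ((TensorProduct.assoc k V D W).toLinearMap ∘ₗ ρ.rTensor W).rTensor Z (t x) =
      (l.lTensor V).rTensor Z (t x)) :
    U →ₗ[k] Cotensor ρ l ⊗[k] Z :=
  liftR _ _ t h

theorem intoCotR_spec (ρ : V →ₗ[k] V ⊗[k] D) (l : W →ₗ[k] D ⊗[k] W)
    (t : U →ₗ[k] (V ⊗[k] W) ⊗[k] Z)
    (h : ∀ x, ((TensorProduct.assoc k V D W).toLinearMap ∘ₗ ρ.rTensor W).rTensor Z (t x) =
      (l.lTensor V).rTensor Z (t x)) (x : U) :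
    (incl ρ l).rTensor Z (intoCotR ρ l t h x) = t x :=
  liftR_spec _ _ t h x

/-- Coassociativity and counitality of a right coaction. -/
structure IsRightCoaction [Coalgebra k C] (ρ : V →ₗ[k] V ⊗[k] C) : Prop where
  coassoc : ∀ v, TensorProduct.assoc k V C C (ρ.rTensor C (ρ v)) =
    (Coalgebra.comul (R := k) (A := C)).lTensor V (ρ v)
  counit : ∀ v, (Coalgebra.counit (R := k) (A := C)).lTensor V (ρ v) = v ⊗ₜ[k] (1 : k)

/-- Coassociativity and counitality of a left coaction. -/
structure IsLeftCoaction [Coalgebra k C] (l : V →ₗ[k] C ⊗[k] V) : Prop where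
  coassoc : ∀ v, TensorProduct.assoc k C C V
    ((Coalgebra.comul (R := k) (A := C)).rTensor V (l v)) = l.lTensor C (l v)
  counit : ∀ v, (Coalgebra.counit (R := k) (A := C)).rTensor V (l v) = (1 : k) ⊗ₜ[k] v

/-- The compatibility of a left and a right coaction in a bicomodule. -/
def Commutes (l : V →ₗ[k] C ⊗[k] V) (ρ : V →ₗ[k] V ⊗[k] D) : Prop :=
  ∀ v, TensorProduct.assoc k C V D (l.rTensor D (ρ v)) = ρ.lTensor C (l v)

/-- `g` is a map of right comodules. -/
def RColinear (ρ : V →ₗ[k] V ⊗[k] D) (ρ' : V' →ₗ[k] V' ⊗[k] D) (g : V →ₗ[k] V') : Prop :=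
  ∀ v, ρ' (g v) = g.rTensor D (ρ v)

/-- `g` is a map of left comodules. -/
def LColinear (l : V →ₗ[k] D ⊗[k] V) (l' : V' →ₗ[k] D ⊗[k] V') (g : V →ₗ[k] V') : Prop :=
  ∀ v, l' (g v) = g.lTensor D (l v)

theorem RColinear.id (ρ : V →ₗ[k] V ⊗[k] D) : RColinear ρ ρ LinearMap.id := fun v => by simp

theorem LColinear.id (l : V →ₗ[k] D ⊗[k] V) : LColinear l l LinearMap.id := fun v => by simp

/-- Functoriality `g □ h : V □ W → V' □ W'` of the cotensor product. -/
def cotMap {ρ : V →ₗ[k] V ⊗[k] D} {ρ' : V' →ₗ[k] V' ⊗[k] D}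
    {l : W →ₗ[k] D ⊗[k] W} {l' : W' →ₗ[k] D ⊗[k] W'}
    (g : V →ₗ[k] V') (h : W →ₗ[k] W') (hg : RColinear ρ ρ' g) (hh : LColinear l l' h) :
    Cotensor ρ l →ₗ[k] Cotensor ρ' l' :=
  intoCot ρ' l' (TensorProduct.map g h ∘ₗ incl ρ l) (fun x => by
    have hx := incl_cond ρ l x
    have e1 : ∀ x : V ⊗[k] W,
        TensorProduct.assoc k V' D W' (ρ'.rTensor W' (TensorProduct.map g h x)) =
        TensorProduct.map g (h.lTensor D) (TensorProduct.assoc k V D W (ρ.rTensor W x)) := by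
      intro x
      refine x.induction_on (by simp) (fun a b => ?_)
        (fun _ _ ha hb => by simp only [map_add, ha, hb])
      obtain ⟨S, hS⟩ := exists_finset (ρ a)
      simp [hg a, hS, sum_tmul]
    have e2 : ∀ x : V ⊗[k] W, l'.lTensor V' (TensorProduct.map g h x) =
        TensorProduct.map g (h.lTensor D) (l.lTensor V x) := by
      intro x
      refine x.induction_on (by simp) (fun a b => ?_)
        (fun _ _ ha hb => by simp only [map_add, ha, hb])
      simp [hh b]
    rw [LinearMap.comp_apply, e1, e2, hx])

@[simp]
theorem coe_cotMap {ρ : V →ₗ[k] V ⊗[k] D} {ρ' : V' →ₗ[k] V' ⊗[k] D}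
    {l : W →ₗ[k] D ⊗[k] W} {l' : W' →ₗ[k] D ⊗[k] W'}
    (g : V →ₗ[k] V') (h : W →ₗ[k] W') (hg : RColinear ρ ρ' g) (hh : LColinear l l' h)
    (x : Cotensor ρ l) :
    incl ρ' l' (cotMap g h hg hh x) = TensorProduct.map g h (incl ρ l x) := rfl

/-- The right coaction on `V □_D W` induced by a right coaction `r` on `W`: the corestriction of
`V ⊗ r` to `(V □_D W) ⊗ C ⊆ V ⊗ W ⊗ C`. -/
def cotR (ρ : V →ₗ[k] V ⊗[k] D) (l : W →ₗ[k] D ⊗[k] W) (r : W →ₗ[k] W ⊗[k] C)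
    (hc : Commutes l r) : Cotensor ρ l →ₗ[k] Cotensor ρ l ⊗[k] C :=
  intoCotR ρ l ((TensorProduct.assoc k V W C).symm.toLinearMap ∘ₗ r.lTensor V ∘ₗ
    (incl ρ l)) (by
      intro x
      have hx := incl_cond ρ l x
      let Φ : V ⊗[k] (D ⊗[k] W) →ₗ[k] (V ⊗[k] (D ⊗[k] W)) ⊗[k] C :=
        (TensorProduct.assoc k V (D ⊗[k] W) C).symm.toLinearMap ∘ₗ
          ((TensorProduct.assoc k D W C).symm.toLinearMap ∘ₗ r.lTensor D).lTensor V
      have e1 : ∀ x : V ⊗[k] W, ((TensorProduct.assoc k V D W).toLinearMap ∘ₗ ρ.rTensor W).rTensor C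
          ((TensorProduct.assoc k V W C).symm (r.lTensor V x)) =
          Φ (TensorProduct.assoc k V D W (ρ.rTensor W x)) := by
        intro x
        refine x.induction_on (by simp) (fun a b => ?_)
          (fun _ _ ha hb => by simp only [map_add, ha, hb])
        obtain ⟨S, hS⟩ := exists_finset (ρ a)
        obtain ⟨T, hT⟩ := exists_finset (r b)
        simp [Φ, hS, hT, sum_tmul, tmul_sum]
        try exact Finset.sum_comm
      have e2 : ∀ x : V ⊗[k] W, (l.lTensor V).rTensor C
          ((TensorProduct.assoc k V W C).symm (r.lTensor V x)) = Φ (l.lTensor V x) := by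
        intro x
        refine x.induction_on (by simp) (fun a b => ?_)
          (fun _ _ ha hb => by simp only [map_add, ha, hb])
        have := hc b
        simp only [Φ, LinearMap.comp_apply, LinearMap.lTensor_tmul, LinearEquiv.coe_coe]
        rw [← this, LinearEquiv.symm_apply_apply]
        obtain ⟨T, hT⟩ := exists_finset (r b)
        simp [hT, tmul_sum]
      simpa [e1, e2] using congrArg Φ hx)

theorem cotR_spec (ρ : V →ₗ[k] V ⊗[k] D) (l : W →ₗ[k] D ⊗[k] W) (r : W →ₗ[k] W ⊗[k] C)
    (hc : Commutes l r) (x : Cotensor ρ l) :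
    (incl ρ l).rTensor C (cotR ρ l r hc x) =
      (TensorProduct.assoc k V W C).symm (r.lTensor V (incl ρ l x)) :=
  intoCotR_spec _ _ _ _ x

/-- The left coaction on `V □_D W` induced by a left coaction `m` on `V`: the corestriction of
`m ⊗ W` to `E ⊗ (V □_D W) ⊆ E ⊗ V ⊗ W`. -/
def cotL (ρ : V →ₗ[k] V ⊗[k] D) (l : W →ₗ[k] D ⊗[k] W) (m : V →ₗ[k] E ⊗[k] V)
    (hc : Commutes m ρ) : Cotensor ρ l →ₗ[k] E ⊗[k] Cotensor ρ l :=
  intoCotL ρ l ((TensorProduct.assoc k E V W).toLinearMap ∘ₗ m.rTensor W ∘ₗ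
    (incl ρ l)) (by
      intro x
      have hx := incl_cond ρ l x
      let Φ : V ⊗[k] (D ⊗[k] W) →ₗ[k] E ⊗[k] (V ⊗[k] (D ⊗[k] W)) :=
        (TensorProduct.assoc k E V (D ⊗[k] W)).toLinearMap ∘ₗ m.rTensor (D ⊗[k] W)
      have e1 : ∀ x : V ⊗[k] W, ((TensorProduct.assoc k V D W).toLinearMap ∘ₗ ρ.rTensor W).lTensor E
          (TensorProduct.assoc k E V W (m.rTensor W x)) =
          Φ (TensorProduct.assoc k V D W (ρ.rTensor W x)) := by
        intro x
        refine x.induction_on (by simp) (fun a b => ?_)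
          (fun _ _ ha hb => by simp only [map_add, ha, hb])
        have h := congrArg (fun t => (TensorProduct.assoc k V D W).toLinearMap.lTensor E
          (TensorProduct.assoc k E (V ⊗[k] D) W (t ⊗ₜ[k] b))) (hc a)
        obtain ⟨T, hT⟩ := exists_finset (m a)
        obtain ⟨S, hS⟩ := exists_finset (ρ a)
        choose T' hT' using fun v => exists_finset (m v)
        simp only [hS, hT, map_sum, sum_tmul, LinearMap.rTensor_tmul, LinearMap.lTensor_tmul,
          TensorProduct.assoc_tmul, LinearEquiv.coe_coe, hT', Φ, LinearMap.comp_apply] at h ⊢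
        exact h.symm
      have e2 : ∀ x : V ⊗[k] W, (l.lTensor V).lTensor E
          (TensorProduct.assoc k E V W (m.rTensor W x)) = Φ (l.lTensor V x) := by
        intro x
        refine x.induction_on (by simp) (fun a b => ?_)
          (fun _ _ ha hb => by simp only [map_add, ha, hb])
        obtain ⟨T, hT⟩ := exists_finset (m a)
        simp [Φ, hT, sum_tmul]
      simpa [e1, e2] using congrArg Φ hx)

theorem cotL_spec (ρ : V →ₗ[k] V ⊗[k] D) (l : W →ₗ[k] D ⊗[k] W) (m : V →ₗ[k] E ⊗[k] V)
    (hc : Commutes m ρ) (x : Cotensor ρ l) :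
    (incl ρ l).lTensor E (cotL ρ l m hc x) =
      TensorProduct.assoc k E V W (m.rTensor W (incl ρ l x)) :=
  intoCotL_spec _ _ _ _ x

theorem natR (g : X →ₗ[k] Y) (t : X ⊗[k] U) (z : Z) :
    g.rTensor (U ⊗[k] Z) (TensorProduct.assoc k X U Z (t ⊗ₜ[k] z)) =
      TensorProduct.assoc k Y U Z (g.rTensor U t ⊗ₜ[k] z) := by
  refine t.induction_on (by simp) (fun a b => ?_)
    (fun _ _ ha hb => by simp only [map_add, add_tmul, ha, hb])
  simp

/-- The right coaction on a Cotensor product is coassociative and counital. -/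
theorem cotR_isRightCoaction [Coalgebra k C] (ρ : V →ₗ[k] V ⊗[k] D) (l : W →ₗ[k] D ⊗[k] W)
    (r : W →ₗ[k] W ⊗[k] C) (hc : Commutes l r) (hr : IsRightCoaction r) :
    IsRightCoaction (cotR ρ l r hc) where
  coassoc y := by
    apply rTensor_inj _ (incl_injective ρ l)
    have h1 : ∀ z, (incl ρ l).rTensor (C ⊗[k] C)
        (TensorProduct.assoc k _ C C ((cotR ρ l r hc).rTensor C z)) =
        TensorProduct.assoc k _ C C (((TensorProduct.assoc k V W C).symm.toLinearMap ∘ₗ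
          r.lTensor V).rTensor C ((incl ρ l).rTensor C z)) := by
      intro z
      refine z.induction_on (by simp) (fun a b => ?_)
        (fun _ _ ha hb => by simp only [map_add, ha, hb])
      simp only [LinearMap.rTensor_tmul]
      rw [natR, cotR_spec]
      simp
    have h2 : ∀ z, (incl ρ l).rTensor (C ⊗[k] C)
        ((Coalgebra.comul (R := k) (A := C)).lTensor _ z) =
        (Coalgebra.comul (R := k) (A := C)).lTensor _ ((incl ρ l).rTensor C z) := by
      intro z
      refine z.induction_on (by simp) (fun a b => ?_)
        (fun _ _ ha hb => by simp only [map_add, ha, hb])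
      simp
    have h3 : ∀ x : V ⊗[k] W, TensorProduct.assoc k _ C C
        (((TensorProduct.assoc k V W C).symm.toLinearMap ∘ₗ r.lTensor V).rTensor C
          ((TensorProduct.assoc k V W C).symm (r.lTensor V x))) =
        (Coalgebra.comul (R := k) (A := C)).lTensor _
          ((TensorProduct.assoc k V W C).symm (r.lTensor V x)) := by
      intro x
      refine x.induction_on (by simp) (fun a b => ?_)
        (fun _ _ ha hb => by simp only [map_add, ha, hb])
      have h := congrArg (fun t => (TensorProduct.assoc k V W (C ⊗[k] C)).symm (a ⊗ₜ[k] t))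
        (hr.coassoc b)
      choose S hS using fun w => exists_finset (r w)
      choose T hT using fun c => exists_finset (Coalgebra.comul (R := k) (A := C) c)
      simp only [hS, hT, map_sum, sum_tmul, tmul_sum, LinearMap.rTensor_tmul,
        LinearMap.lTensor_tmul, TensorProduct.assoc_tmul, TensorProduct.assoc_symm_tmul,
        LinearEquiv.coe_coe, LinearMap.comp_apply] at h ⊢
      exact h
    rw [h1, h2, cotR_spec, h3]
  counit y := by
    apply rTensor_inj _ (incl_injective ρ l)
    have h2 : ∀ z, (incl ρ l).rTensor k
        ((Coalgebra.counit (R := k) (A := C)).lTensor _ z) =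
        (Coalgebra.counit (R := k) (A := C)).lTensor _ ((incl ρ l).rTensor C z) := by
      intro z
      refine z.induction_on (by simp) (fun a b => ?_)
        (fun _ _ ha hb => by simp only [map_add, ha, hb])
      simp
    have h3 : ∀ x : V ⊗[k] W, (Coalgebra.counit (R := k) (A := C)).lTensor _
          ((TensorProduct.assoc k V W C).symm (r.lTensor V x)) = x ⊗ₜ[k] (1 : k) := by
      intro x
      refine x.induction_on (by simp) (fun a b => ?_)
        (fun _ _ ha hb => by simp only [map_add, add_tmul, ha, hb])
      have h := congrArg (fun t => (TensorProduct.assoc k V W k).symm (a ⊗ₜ[k] t))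
        (hr.counit b)
      choose S hS using fun w => exists_finset (r w)
      simp only [hS, map_sum, tmul_sum, LinearMap.lTensor_tmul,
        TensorProduct.assoc_symm_tmul] at h ⊢
      exact h
    rw [h2, cotR_spec, h3]
    simp

/-- The left coaction on a Cotensor product is coassociative and counital. -/
theorem cotL_isLeftCoaction [Coalgebra k E] (ρ : V →ₗ[k] V ⊗[k] D) (l : W →ₗ[k] D ⊗[k] W)
    (m : V →ₗ[k] E ⊗[k] V) (hc : Commutes m ρ) (hm : IsLeftCoaction m) :
    IsLeftCoaction (cotL ρ l m hc) where
  coassoc y := by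
    apply Module.Flat.lTensor_preserves_injective_linearMap (M := E) _
      (lTensor_inj (Z := E) _ (incl_injective ρ l))
    have h1 : ∀ z, ((incl ρ l).lTensor E).lTensor E ((cotL ρ l m hc).lTensor E z) =
        ((TensorProduct.assoc k E V W).toLinearMap ∘ₗ m.rTensor W).lTensor E
          ((incl ρ l).lTensor E z) := by
      intro z
      refine z.induction_on (by simp) (fun a b => ?_)
        (fun _ _ ha hb => by simp only [map_add, ha, hb])
      simp only [LinearMap.lTensor_tmul]
      rw [cotL_spec]
      simp
    have h2 : ∀ z, ((incl ρ l).lTensor E).lTensor E (TensorProduct.assoc k E E _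
        ((Coalgebra.comul (R := k) (A := E)).rTensor _ z)) =
        TensorProduct.assoc k E E _ ((Coalgebra.comul (R := k) (A := E)).rTensor _
          ((incl ρ l).lTensor E z)) := by
      intro z
      refine z.induction_on (by simp) (fun a b => ?_)
        (fun _ _ ha hb => by simp only [map_add, ha, hb])
      obtain ⟨T, hT⟩ := exists_finset (Coalgebra.comul (R := k) (A := E) a)
      simp [hT, sum_tmul]
    have h3 : ∀ x : V ⊗[k] W, TensorProduct.assoc k E E _
        ((Coalgebra.comul (R := k) (A := E)).rTensor _
          (TensorProduct.assoc k E V W (m.rTensor W x))) =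
        ((TensorProduct.assoc k E V W).toLinearMap ∘ₗ m.rTensor W).lTensor E
          (TensorProduct.assoc k E V W (m.rTensor W x)) := by
      intro x
      refine x.induction_on (by simp) (fun a b => ?_)
        (fun _ _ ha hb => by simp only [map_add, ha, hb])
      have h := congrArg (fun t => (TensorProduct.assoc k E V W).toLinearMap.lTensor E
        (TensorProduct.assoc k E (E ⊗[k] V) W (t ⊗ₜ[k] b))) (hm.coassoc a)
      choose S hS using fun w => exists_finset (m w)
      choose T hT using fun c => exists_finset (Coalgebra.comul (R := k) (A := E) c)
      simp only [hS, hT, map_sum, sum_tmul, tmul_sum, LinearMap.rTensor_tmul,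
        LinearMap.lTensor_tmul, TensorProduct.assoc_tmul,
        LinearEquiv.coe_coe, LinearMap.comp_apply] at h ⊢
      exact h
    rw [h1, h2, cotL_spec, h3]
  counit y := by
    apply lTensor_inj _ (incl_injective ρ l)
    have h2 : ∀ z, (incl ρ l).lTensor k
        ((Coalgebra.counit (R := k) (A := E)).rTensor _ z) =
        (Coalgebra.counit (R := k) (A := E)).rTensor _ ((incl ρ l).lTensor E z) := by
      intro z
      refine z.induction_on (by simp) (fun a b => ?_)
        (fun _ _ ha hb => by simp only [map_add, ha, hb])
      simp
    have h3 : ∀ x : V ⊗[k] W, (Coalgebra.counit (R := k) (A := E)).rTensor _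
          (TensorProduct.assoc k E V W (m.rTensor W x)) = (1 : k) ⊗ₜ[k] x := by
      intro x
      refine x.induction_on (by simp) (fun a b => ?_)
        (fun _ _ ha hb => by simp only [map_add, tmul_add, ha, hb])
      have h := congrArg (fun t => TensorProduct.assoc k k V W (t ⊗ₜ[k] b)) (hm.counit a)
      choose S hS using fun w => exists_finset (m w)
      simp only [hS, map_sum, sum_tmul, LinearMap.rTensor_tmul,
        TensorProduct.assoc_tmul] at h ⊢
      exact h
    rw [h2, cotL_spec, h3]
    simp

/-- The two induced coactions make `V □_D W` a bicomodule. -/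
theorem cot_commutes (ρ : V →ₗ[k] V ⊗[k] D) (l : W →ₗ[k] D ⊗[k] W) (m : V →ₗ[k] E ⊗[k] V)
    (hm : Commutes m ρ) (r : W →ₗ[k] W ⊗[k] C) (hr : Commutes l r) :
    Commutes (cotL ρ l m hm) (cotR ρ l r hr) := by
  intro y
  apply Module.Flat.lTensor_preserves_injective_linearMap (M := E) _
      (rTensor_inj (Z := C) _ (incl_injective ρ l))
  have h1 : ∀ z, ((incl ρ l).rTensor C).lTensor E ((cotR ρ l r hr).lTensor E z) =
      ((TensorProduct.assoc k V W C).symm.toLinearMap ∘ₗ r.lTensor V).lTensor E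
        ((incl ρ l).lTensor E z) := by
    intro z
    refine z.induction_on (by simp) (fun a b => ?_)
      (fun _ _ ha hb => by simp only [map_add, ha, hb])
    simp only [LinearMap.lTensor_tmul]
    rw [cotR_spec]
    simp
  have h0 : ∀ (t : E ⊗[k] Cotensor ρ l) (c : C), ((incl ρ l).rTensor C).lTensor E
      (TensorProduct.assoc k E _ C (t ⊗ₜ[k] c)) = TensorProduct.assoc k E _ C
        ((incl ρ l).lTensor E t ⊗ₜ[k] c) := by
    intro t c
    refine t.induction_on (by simp) (fun a b => ?_)
      (fun _ _ ha hb => by simp only [map_add, add_tmul, ha, hb])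
    simp
  have h2 : ∀ z, ((incl ρ l).rTensor C).lTensor E
      (TensorProduct.assoc k E _ C ((cotL ρ l m hm).rTensor C z)) =
      TensorProduct.assoc k E _ C (((TensorProduct.assoc k E V W).toLinearMap ∘ₗ
        m.rTensor W).rTensor C ((incl ρ l).rTensor C z)) := by
    intro z
    refine z.induction_on (by simp) (fun a b => ?_)
      (fun _ _ ha hb => by simp only [map_add, ha, hb])
    simp only [LinearMap.rTensor_tmul]
    rw [h0, cotL_spec]
    simp
  have h3 : ∀ x : V ⊗[k] W, TensorProduct.assoc k E _ C
      (((TensorProduct.assoc k E V W).toLinearMap ∘ₗ m.rTensor W).rTensor C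
        ((TensorProduct.assoc k V W C).symm (r.lTensor V x))) =
      ((TensorProduct.assoc k V W C).symm.toLinearMap ∘ₗ r.lTensor V).lTensor E
        (TensorProduct.assoc k E V W (m.rTensor W x)) := by
    intro x
    refine x.induction_on (by simp) (fun a b => ?_)
      (fun _ _ ha hb => by simp only [map_add, ha, hb])
    obtain ⟨S, hS⟩ := exists_finset (m a)
    obtain ⟨T, hT⟩ := exists_finset (r b)
    simp only [hS, hT, map_sum, sum_tmul, tmul_sum, LinearMap.rTensor_tmul,
        LinearMap.lTensor_tmul, TensorProduct.assoc_tmul, TensorProduct.assoc_symm_tmul,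
        LinearEquiv.coe_coe, LinearMap.comp_apply]
    first | done | exact Finset.sum_comm
  rw [h1, h2, cotR_spec, cotL_spec, h3]

/-- The associativity map `(V □_C W) □_D X → V □_C (W □_D X)`: the restriction of
`(V ⊗ W) ⊗ X ≅ V ⊗ (W ⊗ X)`. -/
def cotAssoc (ρ : V →ₗ[k] V ⊗[k] C) (l : W →ₗ[k] C ⊗[k] W) (r : W →ₗ[k] W ⊗[k] D)
    (hc : Commutes l r) (m : X →ₗ[k] D ⊗[k] X) :
    Cotensor (cotR ρ l r hc) m →ₗ[k] Cotensor ρ (cotL r m l hc) :=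
  intoCot ρ (cotL r m l hc)
    (intoCotL r m
      ((TensorProduct.assoc k V W X).toLinearMap ∘ₗ
      (incl ρ l).rTensor X ∘ₗ incl (cotR ρ l r hc) m) (by
        intro x
        have hx := incl_cond _ _ x
        have h := congrArg (fun t => TensorProduct.assoc k V W (D ⊗[k] X)
          ((incl ρ l).rTensor (D ⊗[k] X) t)) hx
        have e1 : ∀ x, TensorProduct.assoc k V W (D ⊗[k] X) ((incl ρ l).rTensor _
            (TensorProduct.assoc k _ D X ((cotR ρ l r hc).rTensor X x))) =
            ((TensorProduct.assoc k W D X).toLinearMap ∘ₗ r.rTensor X).lTensor V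
              (TensorProduct.assoc k V W X ((incl ρ l).rTensor X x)) := by
          intro x
          refine x.induction_on (by simp) (fun a b => ?_)
            (fun _ _ ha hb => by simp only [map_add, ha, hb])
          simp only [LinearMap.rTensor_tmul]
          rw [natR, cotR_spec]
          generalize incl ρ l a = a'
          refine a'.induction_on (by simp) (fun v w => ?_)
            (fun _ _ ha hb => by simp only [map_add, add_tmul, ha, hb])
          obtain ⟨S, hS⟩ := exists_finset (r w)
          simp [hS, sum_tmul, tmul_sum]
        have e2 : ∀ x, TensorProduct.assoc k V W (D ⊗[k] X) ((incl ρ l).rTensor _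
            (m.lTensor _ x)) = (m.lTensor W).lTensor V
              (TensorProduct.assoc k V W X ((incl ρ l).rTensor X x)) := by
          intro x
          refine x.induction_on (by simp) (fun a b => ?_)
            (fun _ _ ha hb => by simp only [map_add, ha, hb])
          simp only [LinearMap.rTensor_tmul, LinearMap.lTensor_tmul]
          generalize incl ρ l a = a'
          refine a'.induction_on (by simp) (fun v w => ?_)
            (fun _ _ ha hb => by simp only [map_add, add_tmul, ha, hb])
          simp
        simp only [e1, e2] at h
        exact h))
    (by
      intro x
      apply Module.Flat.lTensor_preserves_injective_linearMap (M := V) _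
        (Module.Flat.lTensor_preserves_injective_linearMap (M := C) _
          (incl_injective r m))
      have e1 : ∀ z, ((incl r m).lTensor C).lTensor V
          (TensorProduct.assoc k V C _ (ρ.rTensor _ z)) =
          TensorProduct.assoc k V C _ (ρ.rTensor _ ((incl r m).lTensor V z)) := by
        intro z
        refine z.induction_on (by simp) (fun a b => ?_)
          (fun _ _ ha hb => by simp only [map_add, ha, hb])
        obtain ⟨S, hS⟩ := exists_finset (ρ a)
        simp [hS, sum_tmul]
      have e2 : ∀ z, ((incl r m).lTensor C).lTensor V
          ((cotL r m l hc).lTensor V z) =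
          ((TensorProduct.assoc k C W X).toLinearMap ∘ₗ l.rTensor X).lTensor V
            ((incl r m).lTensor V z) := by
        intro z
        refine z.induction_on (by simp) (fun a b => ?_)
          (fun _ _ ha hb => by simp only [map_add, ha, hb])
        simp only [LinearMap.lTensor_tmul]
        rw [cotL_spec]
        simp
      have e3 : ∀ y : Cotensor ρ l ⊗[k] X, TensorProduct.assoc k V C _ (ρ.rTensor _
          (TensorProduct.assoc k V W X ((incl ρ l).rTensor X y))) =
          ((TensorProduct.assoc k C W X).toLinearMap ∘ₗ l.rTensor X).lTensor V
            (TensorProduct.assoc k V W X ((incl ρ l).rTensor X y)) := by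
        intro y
        refine y.induction_on (by simp) (fun a b => ?_)
          (fun _ _ ha hb => by simp only [map_add, ha, hb])
        have ha := incl_cond ρ l a
        have h := congrArg (fun t => (TensorProduct.assoc k C W X).toLinearMap.lTensor V
          (TensorProduct.assoc k V (C ⊗[k] W) X (t ⊗ₜ[k] b))) ha
        have e4 : ∀ a : V ⊗[k] W, (TensorProduct.assoc k C W X).toLinearMap.lTensor V
            (TensorProduct.assoc k V (C ⊗[k] W) X
              (TensorProduct.assoc k V C W (ρ.rTensor W a) ⊗ₜ[k] b)) =
            TensorProduct.assoc k V C _ (ρ.rTensor _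
              (TensorProduct.assoc k V W X (a ⊗ₜ[k] b))) := by
          intro a
          refine a.induction_on (by simp) (fun v w => ?_)
            (fun _ _ ha hb => by simp only [map_add, add_tmul, ha, hb])
          obtain ⟨S, hS⟩ := exists_finset (ρ v)
          simp [hS, sum_tmul]
        have e5 : ∀ a : V ⊗[k] W, (TensorProduct.assoc k C W X).toLinearMap.lTensor V
            (TensorProduct.assoc k V (C ⊗[k] W) X (l.lTensor V a ⊗ₜ[k] b)) =
            ((TensorProduct.assoc k C W X).toLinearMap ∘ₗ l.rTensor X).lTensor V
              (TensorProduct.assoc k V W X (a ⊗ₜ[k] b)) := by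
          intro a
          refine a.induction_on (by simp) (fun v w => ?_)
            (fun _ _ ha hb => by simp only [map_add, add_tmul, ha, hb])
          simp
        simp only [e4, e5] at h
        exact h
      rw [e1, e2]
      rw [intoCotL_spec]
      exact e3 _)

theorem cotAssoc_spec (ρ : V →ₗ[k] V ⊗[k] C) (l : W →ₗ[k] C ⊗[k] W) (r : W →ₗ[k] W ⊗[k] D)
    (hc : Commutes l r) (m : X →ₗ[k] D ⊗[k] X) (x : Cotensor (cotR ρ l r hc) m) :
    (incl r m).lTensor V (incl _ _ (cotAssoc ρ l r hc m x)) =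
      TensorProduct.assoc k V W X
        ((incl ρ l).rTensor X (incl _ _ x)) := by
  rw [cotAssoc, incl_intoCot, intoCotL_spec]
  rfl

/-- `V ⊗ C → V`, `v ⊗ c ↦ ε(c) v`. -/
def rEps (V : Type v) [AddCommGroup V] [Module k V] [Coalgebra k C] : V ⊗[k] C →ₗ[k] V :=
  (TensorProduct.rid k V).toLinearMap ∘ₗ (Coalgebra.counit (R := k) (A := C)).lTensor V

/-- `C ⊗ W → W`, `c ⊗ w ↦ ε(c) w`. -/
def lEps (W : Type v) [AddCommGroup W] [Module k W] [Coalgebra k C] : C ⊗[k] W →ₗ[k] W :=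
  (TensorProduct.lid k W).toLinearMap ∘ₗ (Coalgebra.counit (R := k) (A := C)).rTensor W

@[simp]
theorem rEps_tmul [Coalgebra k C] (a : V) (c : C) :
    rEps (k := k) V (a ⊗ₜ[k] c) = Coalgebra.counit (R := k) c • a := by
  simp [rEps]

@[simp]
theorem lEps_tmul [Coalgebra k C] (c : C) (a : W) :
    lEps (k := k) W (c ⊗ₜ[k] a) = Coalgebra.counit (R := k) c • a := by
  simp [lEps]

theorem IsRightCoaction.rEps [Coalgebra k C] {ρ : V →ₗ[k] V ⊗[k] C} (h : IsRightCoaction ρ)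
    (a : V) : rEps V (ρ a) = a := by
  have := h.counit a
  simp [CoalgDescent.rEps, this]

theorem comul_isRightCoaction [Coalgebra k C] :
    IsRightCoaction (Coalgebra.comul (R := k) (A := C)) :=
  ⟨fun c => by simp, fun c => by simp⟩

theorem comul_isLeftCoaction [Coalgebra k C] :
    IsLeftCoaction (Coalgebra.comul (R := k) (A := C)) :=
  ⟨fun c => by simp, fun c => by simp⟩

theorem comul_commutes [Coalgebra k C] :
    Commutes (Coalgebra.comul (R := k) (A := C)) (Coalgebra.comul (R := k) (A := C)) :=
  fun c => by simp

variable [Coalgebra k C] [Coalgebra k D]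

/-- The corestriction of a right `C`-coaction along a coalgebra morphism `f : C → D`. -/
def corestR (f : C →ₗc[k] D) (ρ : V →ₗ[k] V ⊗[k] C) : V →ₗ[k] V ⊗[k] D :=
  (f : C →ₗ[k] D).lTensor V ∘ₗ ρ

/-- The corestriction of a left `C`-coaction along a coalgebra morphism `f : C → D`. -/
def corestL (f : C →ₗc[k] D) (l : V →ₗ[k] C ⊗[k] V) : V →ₗ[k] D ⊗[k] V :=
  (f : C →ₗ[k] D).rTensor V ∘ₗ l

theorem corestR_isRightCoaction (f : C →ₗc[k] D) {ρ : V →ₗ[k] V ⊗[k] C}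
    (h : IsRightCoaction ρ) : IsRightCoaction (corestR f ρ) where
  coassoc a := by
    have h1 := congrArg ((TensorProduct.map (f : C →ₗ[k] D) (f : C →ₗ[k] D)).lTensor V)
      (h.coassoc a)
    have e1 : ∀ z, TensorProduct.assoc k V D D ((corestR f ρ).rTensor D
        ((f : C →ₗ[k] D).lTensor V z)) =
        (TensorProduct.map (f : C →ₗ[k] D) (f : C →ₗ[k] D)).lTensor V
          (TensorProduct.assoc k V C C (ρ.rTensor C z)) := by
      intro z
      refine z.induction_on (by simp) (fun a b => ?_)
        (fun _ _ ha hb => by simp only [map_add, ha, hb])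
      obtain ⟨S, hS⟩ := exists_finset (ρ a)
      simp [corestR, hS, sum_tmul]
    have e2 : ∀ z, (Coalgebra.comul (R := k) (A := D)).lTensor V
        ((f : C →ₗ[k] D).lTensor V z) =
        (TensorProduct.map (f : C →ₗ[k] D) (f : C →ₗ[k] D)).lTensor V
          ((Coalgebra.comul (R := k) (A := C)).lTensor V z) := by
      intro z
      refine z.induction_on (by simp) (fun a b => ?_)
        (fun _ _ ha hb => by simp only [map_add, ha, hb])
      have := CoalgHomClass.map_comp_comul_apply f b
      simp only [LinearMap.lTensor_tmul]
      exact congrArg (fun t => a ⊗ₜ[k] t) this.symm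
    change TensorProduct.assoc k V D D ((corestR f ρ).rTensor D
        ((f : C →ₗ[k] D).lTensor V (ρ a))) = (Coalgebra.comul (R := k) (A := D)).lTensor V
        ((f : C →ₗ[k] D).lTensor V (ρ a))
    rw [e1, e2, h1]
  counit a := by
    have e2 : ∀ z, (Coalgebra.counit (R := k) (A := D)).lTensor V
        ((f : C →ₗ[k] D).lTensor V z) = (Coalgebra.counit (R := k) (A := C)).lTensor V z := by
      intro z
      refine z.induction_on (by simp) (fun a b => ?_)
        (fun _ _ ha hb => by simp only [map_add, ha, hb])
      simp
    change (Coalgebra.counit (R := k) (A := D)).lTensor V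
        ((f : C →ₗ[k] D).lTensor V (ρ a)) = _
    rw [e2, h.counit]

theorem corestL_isLeftCoaction (f : C →ₗc[k] D) {l : V →ₗ[k] C ⊗[k] V}
    (h : IsLeftCoaction l) : IsLeftCoaction (corestL f l) where
  coassoc a := by
    have h1 := congrArg (((f : C →ₗ[k] D).rTensor V ∘ₗ LinearMap.id).lTensor D)
      (congrArg ((f : C →ₗ[k] D).rTensor (C ⊗[k] V)) (h.coassoc a))
    have e1 : ∀ z, (corestL f l).lTensor D ((f : C →ₗ[k] D).rTensor V z) =
        ((f : C →ₗ[k] D).rTensor V ∘ₗ LinearMap.id).lTensor D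
          ((f : C →ₗ[k] D).rTensor (C ⊗[k] V) (l.lTensor C z)) := by
      intro z
      refine z.induction_on (by simp) (fun a b => ?_)
        (fun _ _ ha hb => by simp only [map_add, ha, hb])
      simp [corestL]
    have e2 : ∀ z, TensorProduct.assoc k D D V ((Coalgebra.comul (R := k) (A := D)).rTensor V
        ((f : C →ₗ[k] D).rTensor V z)) =
        ((f : C →ₗ[k] D).rTensor V ∘ₗ LinearMap.id).lTensor D
          ((f : C →ₗ[k] D).rTensor (C ⊗[k] V) (TensorProduct.assoc k C C V
          ((Coalgebra.comul (R := k) (A := C)).rTensor V z))) := by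
      intro z
      refine z.induction_on (by simp) (fun a b => ?_)
        (fun _ _ ha hb => by simp only [map_add, ha, hb])
      have := CoalgHomClass.map_comp_comul_apply f a
      obtain ⟨S, hS⟩ := exists_finset (Coalgebra.comul (R := k) (A := C) a)
      simp [← this, hS, sum_tmul]
    change TensorProduct.assoc k D D V ((Coalgebra.comul (R := k) (A := D)).rTensor V
        ((f : C →ₗ[k] D).rTensor V (l a))) = (corestL f l).lTensor D
        ((f : C →ₗ[k] D).rTensor V (l a))
    rw [e1, e2, h1]
  counit a := by
    have e2 : ∀ z, (Coalgebra.counit (R := k) (A := D)).rTensor V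
        ((f : C →ₗ[k] D).rTensor V z) = (Coalgebra.counit (R := k) (A := C)).rTensor V z := by
      intro z
      refine z.induction_on (by simp) (fun a b => ?_)
        (fun _ _ ha hb => by simp only [map_add, ha, hb])
      simp
    change (Coalgebra.counit (R := k) (A := D)).rTensor V
        ((f : C →ₗ[k] D).rTensor V (l a)) = _
    rw [e2, h.counit]

theorem Commutes.corestR (f : C →ₗc[k] D) {l : V →ₗ[k] E ⊗[k] V} {ρ : V →ₗ[k] V ⊗[k] C}
    (h : Commutes l ρ) : Commutes l (corestR f ρ) := by
  intro a
  have h1 := congrArg (((f : C →ₗ[k] D).lTensor V).lTensor E) (h a)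
  have e1 : ∀ z, TensorProduct.assoc k E V D (l.rTensor D ((f : C →ₗ[k] D).lTensor V z)) =
      ((f : C →ₗ[k] D).lTensor V).lTensor E (TensorProduct.assoc k E V C (l.rTensor C z)) := by
    intro z
    refine z.induction_on (by simp) (fun a b => ?_)
      (fun _ _ ha hb => by simp only [map_add, ha, hb])
    obtain ⟨S, hS⟩ := exists_finset (l a)
    simp [hS, sum_tmul]
  change TensorProduct.assoc k E V D (l.rTensor D ((f : C →ₗ[k] D).lTensor V (ρ a))) = _
  rw [e1, h1, CoalgDescent.corestR, LinearMap.lTensor_comp, LinearMap.comp_apply]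

theorem Commutes.corestL (f : C →ₗc[k] D) {l : V →ₗ[k] C ⊗[k] V} {ρ : V →ₗ[k] V ⊗[k] E}
    (h : Commutes l ρ) : Commutes (corestL f l) ρ := by
  intro a
  have h1 := congrArg ((f : C →ₗ[k] D).rTensor (V ⊗[k] E)) (h a)
  have e1 : ∀ z, ρ.lTensor D ((f : C →ₗ[k] D).rTensor V z) =
      (f : C →ₗ[k] D).rTensor (V ⊗[k] E) (ρ.lTensor C z) := by
    intro z
    refine z.induction_on (by simp) (fun a b => ?_)
      (fun _ _ ha hb => by simp only [map_add, ha, hb])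
    simp
  have e2 : ∀ z, TensorProduct.assoc k D V E ((CoalgDescent.corestL f l).rTensor E z) =
      (f : C →ₗ[k] D).rTensor (V ⊗[k] E) (TensorProduct.assoc k C V E (l.rTensor E z)) := by
    intro z
    refine z.induction_on (by simp) (fun a b => ?_)
      (fun _ _ ha hb => by simp only [map_add, ha, hb])
    obtain ⟨S, hS⟩ := exists_finset (l a)
    simp [CoalgDescent.corestL, hS, sum_tmul]
  change _ = ρ.lTensor D ((f : C →ₗ[k] D).rTensor V (l a))
  rw [e1, e2, h1]

/-- `C` as a left `D`-comodule along `f`. -/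
abbrev lamf (f : C →ₗc[k] D) : C →ₗ[k] D ⊗[k] C := corestL f (Coalgebra.comul (R := k) (A := C))

/-- `C` as a right `D`-comodule along `f`. -/
abbrev rhof (f : C →ₗc[k] D) : C →ₗ[k] C ⊗[k] D := corestR f (Coalgebra.comul (R := k) (A := C))

theorem lamf_commutes (f : C →ₗc[k] D) : Commutes (lamf f) (Coalgebra.comul (R := k) (A := C)) :=
  comul_commutes.corestL f

theorem rhof_commutes (f : C →ₗc[k] D) : Commutes (Coalgebra.comul (R := k) (A := C)) (rhof f) :=
  comul_commutes.corestR f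

/-- On `W □_D C`: `w₀ ⊗ w₁ ε(c) = w ⊗ f(c)`. -/
theorem coact_rEps (f : C →ₗc[k] D) (ρ : W →ₗ[k] W ⊗[k] D) (y : Cotensor ρ (lamf f)) :
    ρ (rEps W (incl _ _ y)) = (f : C →ₗ[k] D).lTensor W (incl _ _ y) := by
  have h := congrArg ((rEps (k := k) (C := C) D).lTensor W) (incl_cond _ _ y)
  have e1 : ∀ z, (rEps (k := k) (C := C) D).lTensor W
      (TensorProduct.assoc k W D C (ρ.rTensor C z)) = ρ (rEps W z) := by
    intro z
    refine z.induction_on (by simp) (fun a b => ?_)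
      (fun _ _ ha hb => by simp only [map_add, ha, hb])
    obtain ⟨S, hS⟩ := exists_finset (ρ a)
    simp [hS, sum_tmul, Finset.smul_sum]
  have e0 : ∀ c, rEps (k := k) (C := C) D (lamf f c) = f c := by
    intro c
    have h0 := congrArg (f : C →ₗ[k] D) (comul_isRightCoaction.rEps (k := k) c)
    have : ∀ z, rEps (k := k) (C := C) D ((f : C →ₗ[k] D).rTensor C z) =
        (f : C →ₗ[k] D) (rEps C z) := by
      intro z
      refine z.induction_on (by simp) (fun a b => ?_)
        (fun _ _ ha hb => by simp only [map_add, ha, hb])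
      simp
    simp only [lamf, corestL, LinearMap.comp_apply]
    rw [this, h0]
    rfl
  have e2 : ∀ z, (rEps (k := k) (C := C) D).lTensor W ((lamf f).lTensor W z) =
      (f : C →ₗ[k] D).lTensor W z := by
    intro z
    refine z.induction_on (by simp) (fun a b => ?_)
      (fun _ _ ha hb => by simp only [map_add, ha, hb])
    simp only [LinearMap.lTensor_tmul, e0]; rfl
  rw [← e1, h, e2]

/-- On `C □_D X`: `ε(c) x₋₁ ⊗ x₀ = f(c) ⊗ x`. -/
theorem coact_lEps (f : C →ₗc[k] D) (l : X →ₗ[k] D ⊗[k] X) (y : Cotensor (rhof f) l) :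
    l (lEps X (incl _ _ y)) = (f : C →ₗ[k] D).rTensor X (incl _ _ y) := by
  have h := congrArg (lEps (k := k) (C := C) (D ⊗[k] X)) (incl_cond _ _ y)
  have e1 : ∀ z, lEps (k := k) (C := C) (D ⊗[k] X) (l.lTensor C z) = l (lEps X z) := by
    intro z
    refine z.induction_on (by simp) (fun a b => ?_)
      (fun _ _ ha hb => by simp only [map_add, ha, hb])
    simp
  have e0 : ∀ c, lEps (k := k) (C := C) D (rhof f c) = f c := by
    intro c
    have h0 : lEps (k := k) C (Coalgebra.comul (R := k) c) = c := by simp [lEps]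
    have : ∀ z, lEps (k := k) (C := C) D ((f : C →ₗ[k] D).lTensor C z) =
        (f : C →ₗ[k] D) (lEps C z) := by
      intro z
      refine z.induction_on (by simp) (fun a b => ?_)
        (fun _ _ ha hb => by simp only [map_add, ha, hb])
      simp
    simp only [rhof, corestR, LinearMap.comp_apply]
    rw [this, h0]
    rfl
  have e2 : ∀ z, lEps (k := k) (C := C) (D ⊗[k] X)
      (TensorProduct.assoc k C D X ((rhof f).rTensor X z)) = (f : C →ₗ[k] D).rTensor X z := by
    intro z
    refine z.induction_on (by simp) (fun a b => ?_)
      (fun _ _ ha hb => by simp only [map_add, ha, hb])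
    have : ∀ t : C ⊗[k] D, lEps (k := k) (C := C) (D ⊗[k] X)
        (TensorProduct.assoc k C D X (t ⊗ₜ[k] b)) = lEps D t ⊗ₜ[k] b := by
      intro t
      refine t.induction_on (by simp) (fun a b => ?_)
        (fun _ _ ha hb => by simp only [map_add, add_tmul, ha, hb])
      simp [smul_tmul']
    simp only [LinearMap.rTensor_tmul, this, e0]; rfl
  rw [← e1, ← h, e2]

/-- The left `C`-coaction of the `C`-bicomodule `C □_D C`. -/
abbrev selfL (f : C →ₗc[k] D) :
    Cotensor (rhof f) (lamf f) →ₗ[k] C ⊗[k] Cotensor (rhof f) (lamf f) :=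
  cotL (rhof f) (lamf f) Coalgebra.comul (rhof_commutes f)

/-- The right `C`-coaction of `W □_D C`, for a right `D`-coaction `ρ` on `W`. -/
abbrev cotC (f : C →ₗc[k] D) (ρ : W →ₗ[k] W ⊗[k] D) :
    Cotensor ρ (lamf f) →ₗ[k] Cotensor ρ (lamf f) ⊗[k] C :=
  cotR ρ (lamf f) Coalgebra.comul (lamf_commutes f)

theorem rEps_comul (z : W ⊗[k] C) : (rEps (C := C) W).rTensor C
    ((TensorProduct.assoc k W C C).symm
      ((Coalgebra.comul (R := k) (A := C)).lTensor W z)) = z := by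
  refine z.induction_on (by simp) (fun a b => ?_)
    (fun _ _ ha hb => by simp only [map_add, ha, hb])
  have h0 : lEps (k := k) C (Coalgebra.comul (R := k) b) = b := by simp [lEps]
  have h1 := congrArg (fun c => a ⊗ₜ[k] c) h0
  obtain ⟨S, hS⟩ := exists_finset (Coalgebra.comul (R := k) (A := C) b)
  simp only [hS, map_sum, tmul_sum, lEps_tmul, LinearMap.lTensor_tmul,
    assoc_symm_tmul, LinearMap.rTensor_tmul, rEps_tmul, smul_tmul] at h1 ⊢
  exact h1

theorem lEps_comul (z : C ⊗[k] W) : (lEps (C := C) W).lTensor C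
    (TensorProduct.assoc k C C W ((Coalgebra.comul (R := k) (A := C)).rTensor W z)) = z := by
  refine z.induction_on (by simp) (fun a b => ?_)
    (fun _ _ ha hb => by simp only [map_add, ha, hb])
  have h0 : rEps (k := k) C (Coalgebra.comul (R := k) a) = a := by simp [rEps]
  have h1 := congrArg (fun c => c ⊗ₜ[k] b) h0
  obtain ⟨S, hS⟩ := exists_finset (Coalgebra.comul (R := k) (A := C) a)
  simp only [hS, map_sum, sum_tmul, lEps_tmul, LinearMap.lTensor_tmul,
    assoc_tmul, LinearMap.rTensor_tmul, rEps_tmul, smul_tmul] at h1 ⊢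
  exact h1

theorem comul_lEps (f : C →ₗc[k] D) (b : Cotensor (rhof f) (lamf f)) :
    Coalgebra.comul (R := k) (lEps C (incl (rhof f) (lamf f) b)) =
      (lEps C ∘ₗ incl (rhof f) (lamf f)).rTensor C (cotC f (rhof f) b) := by
  rw [LinearMap.rTensor_comp, LinearMap.comp_apply, cotR_spec]
  generalize incl (rhof f) (lamf f) b = z
  refine z.induction_on (by simp) (fun a b => ?_)
    (fun _ _ ha hb => by simp only [map_add, ha, hb])
  obtain ⟨S, hS⟩ := exists_finset (Coalgebra.comul (R := k) (A := C) b)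
  simp [hS, tmul_sum, Finset.smul_sum, smul_tmul']

theorem selfL_lEps (f : C →ₗc[k] D) (a : Cotensor (rhof f) (lamf f)) :
    (lEps C ∘ₗ incl (rhof f) (lamf f)).lTensor C (selfL f a) = incl (rhof f) (lamf f) a := by
  rw [LinearMap.lTensor_comp_apply, cotL_spec, lEps_comul]

/-- The action `(W □_D C) □_C (C □_D C) ≅ W □_D C □_D C → W □_D C`, the second arrow being
`id ⊗ ε ⊗ id`. As the isomorphism is induced by `ε ⊗ id : C □_C C ≅ C`, the composite is
`(w ⊗ c) ⊗ (c' ⊗ c'') ↦ ε(c) ε(c') w ⊗ c''`. -/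
def cotAct (f : C →ₗc[k] D) (ρ : W →ₗ[k] W ⊗[k] D) :
    Cotensor (cotC f ρ) (selfL f) →ₗ[k] Cotensor ρ (lamf f) :=
  intoCot ρ (lamf f) (TensorProduct.map (rEps W ∘ₗ incl ρ (lamf f))
    (lEps C ∘ₗ incl (rhof f) (lamf f)) ∘ₗ incl (cotC f ρ) (selfL f)) (by
      intro x
      simp only [LinearMap.comp_apply]
      have h := incl_cond _ _ x
      -- the common target of the two sides of the cotensor condition over `C`
      let T : Cotensor ρ (lamf f) ⊗[k] (C ⊗[k] Cotensor (rhof f) (lamf f)) →ₗ[k]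
          W ⊗[k] (D ⊗[k] C) :=
        TensorProduct.map (rEps W ∘ₗ incl ρ (lamf f))
          (TensorProduct.map (f : C →ₗ[k] D) (lEps C ∘ₗ incl (rhof f) (lamf f)))
      have h1 := congrArg T h
      have e1 : ∀ z, T (TensorProduct.assoc k _ C _ ((cotC f ρ).rTensor _ z)) =
          TensorProduct.assoc k W D C (ρ.rTensor C (TensorProduct.map (rEps W ∘ₗ incl ρ (lamf f))
            (lEps C ∘ₗ incl (rhof f) (lamf f)) z)) := by
        intro z
        refine z.induction_on (by simp) (fun a b => ?_)
          (fun _ _ ha hb => by simp only [map_add, ha, hb])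
        have e3 : ∀ t : Cotensor ρ (lamf f) ⊗[k] C,
            T (TensorProduct.assoc k _ C _ (t ⊗ₜ[k] b)) =
            TensorProduct.assoc k W D C ((f : C →ₗ[k] D).lTensor W
              ((rEps (C := C) W).rTensor C ((incl ρ (lamf f)).rTensor C t)) ⊗ₜ[k]
                lEps C (incl (rhof f) (lamf f) b)) := by
          intro t
          refine t.induction_on (by simp) (fun a b => ?_)
            (fun _ _ ha hb => by simp only [map_add, add_tmul, ha, hb])
          simp [T]
        simp only [LinearMap.rTensor_tmul, TensorProduct.map_tmul, LinearMap.comp_apply]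
        rw [coact_rEps, e3, cotR_spec, rEps_comul]
      have e2 : ∀ z, T ((selfL f).lTensor _ z) =
          (lamf f).lTensor W (TensorProduct.map (rEps W ∘ₗ incl ρ (lamf f))
            (lEps C ∘ₗ incl (rhof f) (lamf f)) z) := by
        intro z
        refine z.induction_on (by simp) (fun a b => ?_)
          (fun _ _ ha hb => by simp only [map_add, ha, hb])
        have e3 : ∀ t : C ⊗[k] Cotensor (rhof f) (lamf f),
            TensorProduct.map (f : C →ₗ[k] D) (lEps C ∘ₗ incl (rhof f) (lamf f)) t =
            (f : C →ₗ[k] D).rTensor C ((lEps (C := C) C).lTensor C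
              ((incl (rhof f) (lamf f)).lTensor C t)) := by
          intro t
          refine t.induction_on (by simp) (fun a b => ?_)
            (fun _ _ ha hb => by simp only [map_add, ha, hb])
          simp
        simp only [LinearMap.lTensor_tmul, TensorProduct.map_tmul, LinearMap.comp_apply, T]
        rw [coact_lEps, e3, cotL_spec, lEps_comul]
      rw [← e1, ← e2, h1])

theorem cotAct_spec (f : C →ₗc[k] D) (ρ : W →ₗ[k] W ⊗[k] D) (x : Cotensor (cotC f ρ) (selfL f)) :
    incl ρ (lamf f) (cotAct f ρ x) = TensorProduct.map (rEps W ∘ₗ incl ρ (lamf f))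
      (lEps C ∘ₗ incl (rhof f) (lamf f)) (incl (cotC f ρ) (selfL f) x) := rfl

theorem self_commutes (f : C →ₗc[k] D) : Commutes (selfL f) (cotC f (rhof f)) :=
  cot_commutes _ _ _ _ _ _

theorem cotAct_rColinear (f : C →ₗc[k] D) (ρ : W →ₗ[k] W ⊗[k] D) :
    RColinear (cotR (cotC f ρ) (selfL f) (cotC f (rhof f)) (self_commutes f)) (cotC f ρ)
      (cotAct f ρ) := by
  intro x
  apply rTensor_inj _ (incl_injective ρ (lamf f))
  have e0 : ∀ z, (incl ρ (lamf f)).rTensor C ((cotAct f ρ).rTensor C z) =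
      (TensorProduct.map (rEps W ∘ₗ incl ρ (lamf f)) (lEps C ∘ₗ incl (rhof f) (lamf f))).rTensor C
        ((incl (cotC f ρ) (selfL f)).rTensor C z) := by
    intro z
    refine z.induction_on (by simp) (fun a b => ?_)
      (fun _ _ ha hb => by simp only [map_add, ha, hb])
    simp only [LinearMap.rTensor_tmul, cotAct_spec]
  have e2 : ∀ z, (TensorProduct.assoc k W C C).symm
      ((Coalgebra.comul (R := k) (A := C)).lTensor W (TensorProduct.map (rEps W ∘ₗ incl ρ (lamf f))
        (lEps C ∘ₗ incl (rhof f) (lamf f)) z)) =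
      (TensorProduct.map (rEps W ∘ₗ incl ρ (lamf f)) (lEps C ∘ₗ incl (rhof f) (lamf f))).rTensor C
        ((TensorProduct.assoc k _ _ C).symm ((cotC f (rhof f)).lTensor _ z)) := by
    intro z
    refine z.induction_on (by simp) (fun a b => ?_)
      (fun _ _ ha hb => by simp only [map_add, ha, hb])
    simp only [TensorProduct.map_tmul, LinearMap.lTensor_tmul, LinearMap.comp_apply]
    rw [comul_lEps]
    obtain ⟨S, hS⟩ := exists_finset (cotC f (rhof f) b)
    simp [hS, tmul_sum]
  rw [e0, cotR_spec, cotR_spec, cotAct_spec, e2]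

theorem cotAct_lColinear (f : C →ₗc[k] D) (ρ : W →ₗ[k] W ⊗[k] D) (m : W →ₗ[k] E ⊗[k] W)
    (hm : Commutes m ρ) :
    LColinear (cotL (cotC f ρ) (selfL f) (cotL ρ (lamf f) m hm) (cot_commutes _ _ _ _ _ _))
      (cotL ρ (lamf f) m hm) (cotAct f ρ) := by
  intro x
  apply lTensor_inj _ (incl_injective ρ (lamf f))
  have e0 : ∀ z, (incl ρ (lamf f)).lTensor E ((cotAct f ρ).lTensor E z) =
      (TensorProduct.map (rEps W ∘ₗ incl ρ (lamf f)) (lEps C ∘ₗ incl (rhof f) (lamf f))).lTensor E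
        ((incl (cotC f ρ) (selfL f)).lTensor E z) := by
    intro z
    refine z.induction_on (by simp) (fun a b => ?_)
      (fun _ _ ha hb => by simp only [map_add, ha, hb])
    simp only [LinearMap.lTensor_tmul, cotAct_spec]
  have e1 : ∀ b, m (rEps W (incl ρ (lamf f) b)) =
      (rEps W ∘ₗ incl ρ (lamf f)).lTensor E (cotL ρ (lamf f) m hm b) := by
    intro b
    rw [LinearMap.lTensor_comp, LinearMap.comp_apply, cotL_spec]
    generalize incl ρ (lamf f) b = z
    refine z.induction_on (by simp) (fun a b => ?_)
      (fun _ _ ha hb => by simp only [map_add, ha, hb])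
    obtain ⟨S, hS⟩ := exists_finset (m a)
    simp [hS, sum_tmul, Finset.smul_sum]
  have e2 : ∀ z, TensorProduct.assoc k E W C (m.rTensor C
      (TensorProduct.map (rEps W ∘ₗ incl ρ (lamf f)) (lEps C ∘ₗ incl (rhof f) (lamf f)) z)) =
      (TensorProduct.map (rEps W ∘ₗ incl ρ (lamf f)) (lEps C ∘ₗ incl (rhof f) (lamf f))).lTensor E
        (TensorProduct.assoc k E _ _ ((cotL ρ (lamf f) m hm).rTensor _ z)) := by
    intro z
    refine z.induction_on (by simp) (fun a b => ?_)
      (fun _ _ ha hb => by simp only [map_add, ha, hb])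
    simp only [TensorProduct.map_tmul, LinearMap.rTensor_tmul, LinearMap.comp_apply]
    rw [e1]
    obtain ⟨S, hS⟩ := exists_finset (cotL ρ (lamf f) m hm a)
    simp [hS, sum_tmul]
  rw [e0, cotL_spec, cotL_spec, cotAct_spec, e2]

theorem cotAct_assoc (f : C →ₗc[k] D) (ρ : W →ₗ[k] W ⊗[k] D)
    (x : Cotensor (cotR (cotC f ρ) (selfL f) (cotC f (rhof f)) (self_commutes f)) (selfL f)) :
    cotAct f ρ (cotMap (cotAct f ρ) LinearMap.id (cotAct_rColinear f ρ) (LColinear.id _) x) =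
      cotAct f ρ (cotMap LinearMap.id (cotAct f (rhof f)) (RColinear.id _)
        (cotAct_lColinear f (rhof f) Coalgebra.comul (rhof_commutes f))
        (cotAssoc (cotC f ρ) (selfL f) (cotC f (rhof f)) (self_commutes f) (selfL f) x)) := by
  apply incl_injective
  have hε : ∀ z : C ⊗[k] C, Coalgebra.counit (R := k) (lEps (k := k) C z) =
      Coalgebra.counit (R := k) (rEps (k := k) C z) := by
    intro z
    refine z.induction_on (by simp) (fun a b => ?_)
      (fun _ _ ha hb => by simp only [map_add, ha, hb])
    simp [mul_comm]
  have e1 : ∀ z, rEps (k := k) (C := C) W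
      (TensorProduct.map (rEps W ∘ₗ incl ρ (lamf f)) (lEps C ∘ₗ incl (rhof f) (lamf f)) z) =
      TensorProduct.rid k W (TensorProduct.map (rEps W ∘ₗ incl ρ (lamf f))
        (Coalgebra.counit (R := k) ∘ₗ rEps C ∘ₗ incl (rhof f) (lamf f)) z) := by
    intro z
    refine z.induction_on (by simp) (fun a b => ?_)
      (fun _ _ ha hb => by simp only [map_add, ha, hb])
    simp [hε]
  have e2 : ∀ z, lEps (k := k) (C := C) C
      (TensorProduct.map (rEps C ∘ₗ incl (rhof f) (lamf f))
        (lEps C ∘ₗ incl (rhof f) (lamf f)) z) =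
      TensorProduct.lid k C (TensorProduct.map (Coalgebra.counit (R := k) ∘ₗ rEps C ∘ₗ
        incl (rhof f) (lamf f)) (lEps C ∘ₗ incl (rhof f) (lamf f)) z) := by
    intro z
    refine z.induction_on (by simp) (fun a b => ?_)
      (fun _ _ ha hb => by simp only [map_add, ha, hb])
    simp
  let G : Cotensor ρ (lamf f) ⊗[k] (Cotensor (rhof f) (lamf f) ⊗[k] Cotensor (rhof f) (lamf f))
      →ₗ[k] W ⊗[k] C :=
    TensorProduct.map (rEps W ∘ₗ incl ρ (lamf f)) ((TensorProduct.lid k C).toLinearMap ∘ₗ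
      TensorProduct.map (Coalgebra.counit (R := k) ∘ₗ rEps C ∘ₗ incl (rhof f) (lamf f))
        (lEps C ∘ₗ incl (rhof f) (lamf f)))
  have e3 : ∀ z, TensorProduct.map (rEps W ∘ₗ incl ρ (lamf f))
      (lEps C ∘ₗ incl (rhof f) (lamf f)) (TensorProduct.map (cotAct f ρ) LinearMap.id z) =
      G (TensorProduct.assoc k _ _ _ ((incl (cotC f ρ) (selfL f)).rTensor _ z)) := by
    intro z
    refine z.induction_on (by simp) (fun a b => ?_)
      (fun _ _ ha hb => by simp only [map_add, ha, hb])
    simp only [TensorProduct.map_tmul, LinearMap.comp_apply, LinearMap.rTensor_tmul,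
      LinearMap.id_apply, cotAct_spec, e1]
    generalize incl (cotC f ρ) (selfL f) a = z
    refine z.induction_on (by simp) (fun a b => ?_)
      (fun _ _ ha hb => by simp only [map_add, add_tmul, ha, hb])
    simp [G, smul_tmul]
  have e4 : ∀ z, TensorProduct.map (rEps W ∘ₗ incl ρ (lamf f))
      (lEps C ∘ₗ incl (rhof f) (lamf f))
        (TensorProduct.map LinearMap.id (cotAct f (rhof f)) z) =
      G ((incl (cotC f (rhof f)) (selfL f)).lTensor _ z) := by
    intro z
    refine z.induction_on (by simp) (fun a b => ?_)
      (fun _ _ ha hb => by simp only [map_add, ha, hb])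
    simp only [TensorProduct.map_tmul, LinearMap.comp_apply, LinearMap.lTensor_tmul,
      LinearMap.id_apply, cotAct_spec, e2, G]
    rfl
  rw [cotAct_spec, cotAct_spec, coe_cotMap, coe_cotMap, e3, e4, cotAssoc_spec]

/-- The coaction of a right `C`-comodule `V` as a map `V → V □_D C`. -/
def unitMap (f : C →ₗc[k] D) (ρ : V →ₗ[k] V ⊗[k] C) (hρ : IsRightCoaction ρ) :
    V →ₗ[k] Cotensor (corestR f ρ) (lamf f) :=
  intoCot _ _ ρ (by
    intro x
    have h := congrArg (((f : C →ₗ[k] D).rTensor C).lTensor V) (hρ.coassoc x)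
    have e1 : ∀ z, TensorProduct.assoc k V D C ((corestR f ρ).rTensor C z) =
        ((f : C →ₗ[k] D).rTensor C).lTensor V (TensorProduct.assoc k V C C (ρ.rTensor C z)) := by
      intro z
      refine z.induction_on (by simp) (fun a b => ?_)
        (fun _ _ ha hb => by simp only [map_add, ha, hb])
      obtain ⟨S, hS⟩ := exists_finset (ρ a)
      simp [corestR, hS, sum_tmul]
    rw [e1, h, ← LinearMap.lTensor_comp_apply]
    rfl)

theorem unitMap_spec (f : C →ₗc[k] D) (ρ : V →ₗ[k] V ⊗[k] C) (hρ : IsRightCoaction ρ) (x : V) :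
    incl _ _ (unitMap f ρ hρ x) = ρ x := rfl

theorem unitMap_rColinear (f : C →ₗc[k] D) (ρ : V →ₗ[k] V ⊗[k] C) (hρ : IsRightCoaction ρ) :
    RColinear ρ (cotC f (corestR f ρ)) (unitMap f ρ hρ) := by
  intro x
  apply rTensor_inj _ (incl_injective _ _)
  rw [cotR_spec, unitMap_spec, ← hρ.coassoc, LinearEquiv.symm_apply_apply,
    ← LinearMap.rTensor_comp_apply]
  rfl

/-- The unit `C → C □_D C`, given by the comultiplication. -/
abbrev selfUnit (f : C →ₗc[k] D) : C →ₗ[k] Cotensor (rhof f) (lamf f) :=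
  unitMap f (Coalgebra.comul (R := k) (A := C)) comul_isRightCoaction

theorem selfUnit_lColinear (f : C →ₗc[k] D) :
    LColinear (Coalgebra.comul (R := k) (A := C)) (selfL f) (selfUnit f) := by
  intro x
  apply lTensor_inj _ (incl_injective _ _)
  rw [cotL_spec, unitMap_spec, comul_isRightCoaction.coassoc,
    ← LinearMap.lTensor_comp_apply]
  rfl

theorem cotAct_unit (f : C →ₗc[k] D) (ρ : W →ₗ[k] W ⊗[k] D)
    (x : Cotensor (cotC f ρ) (Coalgebra.comul (R := k) (A := C))) :
    cotAct f ρ (cotMap LinearMap.id (selfUnit f) (RColinear.id _) (selfUnit_lColinear f) x) =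
      rEps _ (incl _ _ x) := by
  apply incl_injective
  have h := congrArg (TensorProduct.map (rEps W ∘ₗ incl ρ (lamf f)) (rEps (k := k) (C := C) C))
    (incl_cond _ _ x)
  have e1 : ∀ z, TensorProduct.map (rEps W ∘ₗ incl ρ (lamf f)) (lEps C ∘ₗ incl (rhof f) (lamf f))
      (TensorProduct.map LinearMap.id (selfUnit f) z) =
      TensorProduct.map (rEps W ∘ₗ incl ρ (lamf f)) (rEps (k := k) (C := C) C)
        ((Coalgebra.comul (R := k) (A := C)).lTensor _ z) := by
    intro z
    refine z.induction_on (by simp) (fun a b => ?_)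
      (fun _ _ ha hb => by simp only [map_add, ha, hb])
    have h0 : rEps (k := k) C (Coalgebra.comul (R := k) b) = b := by simp [rEps]
    have h1 : lEps (k := k) C (Coalgebra.comul (R := k) b) = b := by simp [lEps]
    simp [unitMap_spec, h0, h1]
  have e2 : ∀ z, TensorProduct.map (rEps W ∘ₗ incl ρ (lamf f)) (rEps (k := k) (C := C) C)
        (TensorProduct.assoc k _ C C ((cotC f ρ).rTensor C z)) =
      incl ρ (lamf f) (rEps _ z) := by
    intro z
    refine z.induction_on (by simp) (fun a b => ?_)
      (fun _ _ ha hb => by simp only [map_add, ha, hb])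
    have e3 : ∀ t, TensorProduct.map (rEps W ∘ₗ incl ρ (lamf f)) (rEps (k := k) (C := C) C)
        (TensorProduct.assoc k _ C C (t ⊗ₜ[k] b)) = Coalgebra.counit (R := k) b •
          (rEps (C := C) W).rTensor C ((incl ρ (lamf f)).rTensor C t) := by
      intro t
      refine t.induction_on (by simp) (fun a b => ?_)
        (fun _ _ ha hb => by simp only [map_add, add_tmul, smul_add, ha, hb])
      simp
    rw [LinearMap.rTensor_tmul, e3, cotR_spec, rEps_comul]
    simp
  rw [cotAct_spec, coe_cotMap, e1, ← h, e2]

theorem cotAct_unit_left (f : C →ₗc[k] D)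
    (x : Cotensor (Coalgebra.comul (R := k) (A := C)) (selfL f)) :
    cotAct f (rhof f) (cotMap (selfUnit f) LinearMap.id
      (unitMap_rColinear f _ comul_isRightCoaction) (LColinear.id _) x) =
      lEps _ (incl _ _ x) := by
  apply incl_injective
  have h := congrArg (TensorProduct.map (LinearMap.id : C →ₗ[k] C) (lEps (k := k) (C := C) C ∘ₗ
    incl (rhof f) (lamf f)) ∘ₗ lEps (k := k) (C := C) (C ⊗[k] Cotensor (rhof f) (lamf f)))
    (incl_cond _ _ x)
  have e1 : ∀ z, TensorProduct.map (rEps C ∘ₗ incl (rhof f) (lamf f))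
      (lEps C ∘ₗ incl (rhof f) (lamf f))
      (TensorProduct.map (selfUnit f) LinearMap.id z) =
      (TensorProduct.map (LinearMap.id : C →ₗ[k] C) (lEps (k := k) (C := C) C ∘ₗ
        incl (rhof f) (lamf f)) ∘ₗ lEps (k := k) (C := C) (C ⊗[k] Cotensor (rhof f) (lamf f)))
        (TensorProduct.assoc k C C _ ((Coalgebra.comul (R := k) (A := C)).rTensor _ z)) := by
    intro z
    refine z.induction_on (by simp) (fun a b => ?_)
      (fun _ _ ha hb => by simp only [map_add, ha, hb])
    have h0 : rEps (k := k) C (Coalgebra.comul (R := k) a) = a := by simp [rEps]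
    have h1 : lEps (k := k) C (Coalgebra.comul (R := k) a) = a := by simp [lEps]
    have e3 : ∀ t : C ⊗[k] C, lEps (k := k) (C := C) (C ⊗[k] Cotensor (rhof f) (lamf f))
        (TensorProduct.assoc k C C _ (t ⊗ₜ[k] b)) = lEps (k := k) C t ⊗ₜ[k] b := by
      intro t
      refine t.induction_on (by simp) (fun a b => ?_)
        (fun _ _ ha hb => by simp only [map_add, add_tmul, ha, hb])
      simp [smul_tmul']
    simp [unitMap_spec, h0, e3, h1]
  have e2 : ∀ z, (TensorProduct.map (LinearMap.id : C →ₗ[k] C) (lEps (k := k) (C := C) C ∘ₗ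
        incl (rhof f) (lamf f)) ∘ₗ lEps (k := k) (C := C) (C ⊗[k] Cotensor (rhof f) (lamf f)))
        ((selfL f).lTensor C z) = incl (rhof f) (lamf f) (lEps _ z) := by
    intro z
    refine z.induction_on (by simp) (fun a b => ?_)
      (fun _ _ ha hb => by simp only [map_add, ha, hb])
    simp only [LinearMap.lTensor_tmul, LinearMap.comp_apply, lEps_tmul, map_smul]
    exact congrArg _ (selfL_lEps f b)
  rw [cotAct_spec, coe_cotMap, e1, h, e2]

/-- The coaction of a right `C`-comodule `V` as a map `V → V □_C C`. -/
def toCot (ρ : V →ₗ[k] V ⊗[k] C) (hρ : IsRightCoaction ρ) :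
    V →ₗ[k] Cotensor ρ (Coalgebra.comul (R := k) (A := C)) :=
  intoCot _ _ ρ hρ.coassoc

theorem toCot_rColinear (f : C →ₗc[k] D) (ρ : V →ₗ[k] V ⊗[k] C) (hρ : IsRightCoaction ρ) :
    RColinear (corestR f ρ) (cotR ρ Coalgebra.comul (rhof f) (rhof_commutes f))
      (toCot ρ hρ) := by
  intro x
  apply rTensor_inj _ (incl_injective _ _)
  rw [cotR_spec, ← LinearMap.rTensor_comp_apply]
  change _ = ρ.rTensor D ((f : C →ₗ[k] D).lTensor V (ρ x))
  change (TensorProduct.assoc k V C D).symm (((f : C →ₗ[k] D).lTensor C ∘ₗ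
    Coalgebra.comul (R := k) (A := C)).lTensor V (ρ x)) = _
  rw [LinearMap.lTensor_comp_apply, ← hρ.coassoc]
  generalize ρ x = z
  refine z.induction_on (by simp) (fun a b => ?_)
    (fun _ _ ha hb => by simp only [map_add, ha, hb])
  obtain ⟨S, hS⟩ := exists_finset (ρ a)
  simp [hS, sum_tmul]

/-- The isomorphism `V □_D C ≅ (V □_C C) □_D C ≅ V □_C (C □_D C)`, for a right `C`-comodule `V`. -/
def expand (f : C →ₗc[k] D) (ρ : V →ₗ[k] V ⊗[k] C) (hρ : IsRightCoaction ρ) :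
    Cotensor (corestR f ρ) (lamf f) →ₗ[k] Cotensor ρ (selfL f) :=
  cotAssoc ρ Coalgebra.comul (rhof f) (rhof_commutes f) (lamf f) ∘ₗ
    cotMap (toCot ρ hρ) LinearMap.id (toCot_rColinear f ρ hρ) (LColinear.id _)

theorem expand_spec (f : C →ₗc[k] D) (ρ : V →ₗ[k] V ⊗[k] C) (hρ : IsRightCoaction ρ)
    (x : Cotensor (corestR f ρ) (lamf f)) :
    (incl (rhof f) (lamf f)).lTensor V (incl _ _ (expand f ρ hρ x)) =
      TensorProduct.assoc k V C C (ρ.rTensor C (incl _ _ x)) := by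
  rw [expand, LinearMap.comp_apply, cotAssoc_spec, coe_cotMap]
  generalize incl (corestR f ρ) (lamf f) x = z
  refine z.induction_on (by simp) (fun a b => ?_)
    (fun _ _ ha hb => by simp only [map_add, ha, hb])
  rfl

/-- The inverse `v ⊗ (c ⊗ c') ↦ ε(c) v ⊗ c'` of `expand`. -/
def contract (f : C →ₗc[k] D) (ρ : V →ₗ[k] V ⊗[k] C) :
    Cotensor ρ (selfL f) →ₗ[k] Cotensor (corestR f ρ) (lamf f) :=
  intoCot _ _ ((lEps C ∘ₗ incl (rhof f) (lamf f)).lTensor V ∘ₗ incl ρ (selfL f)) (by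
    intro y
    have h := congrArg ((TensorProduct.map (f : C →ₗ[k] D)
      (lEps C ∘ₗ incl (rhof f) (lamf f))).lTensor V) (incl_cond _ _ y)
    have e1 : ∀ z, (TensorProduct.map (f : C →ₗ[k] D)
        (lEps C ∘ₗ incl (rhof f) (lamf f))).lTensor V
          (TensorProduct.assoc k V C _ (ρ.rTensor _ z)) =
        TensorProduct.assoc k V D C ((corestR f ρ).rTensor C
          ((lEps C ∘ₗ incl (rhof f) (lamf f)).lTensor V z)) := by
      intro z
      refine z.induction_on (by simp) (fun a b => ?_)
        (fun _ _ ha hb => by simp only [map_add, ha, hb])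
      obtain ⟨S, hS⟩ := exists_finset (ρ a)
      simp [corestR, hS, sum_tmul]
    have e2 : ∀ z, (TensorProduct.map (f : C →ₗ[k] D)
        (lEps C ∘ₗ incl (rhof f) (lamf f))).lTensor V ((selfL f).lTensor V z) =
        (lamf f).lTensor V ((lEps C ∘ₗ incl (rhof f) (lamf f)).lTensor V z) := by
      intro z
      refine z.induction_on (by simp) (fun a b => ?_)
        (fun _ _ ha hb => by simp only [map_add, ha, hb])
      simp only [LinearMap.lTensor_tmul]
      rw [← LinearMap.rTensor_comp_lTensor, LinearMap.comp_apply, selfL_lEps,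
        LinearMap.comp_apply, coact_lEps]
    rw [LinearMap.comp_apply, ← e1, ← e2, h])

theorem expand_contract (f : C →ₗc[k] D) (ρ : V →ₗ[k] V ⊗[k] C) (hρ : IsRightCoaction ρ)
    (y : Cotensor ρ (selfL f)) : expand f ρ hρ (contract f ρ y) = y := by
  apply incl_injective
  apply lTensor_inj _ (incl_injective (rhof f) (lamf f))
  have e1 : ∀ z, TensorProduct.assoc k V C C (ρ.rTensor C
      ((lEps C ∘ₗ incl (rhof f) (lamf f)).lTensor V z)) =
      ((lEps C ∘ₗ incl (rhof f) (lamf f)).lTensor C).lTensor V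
        (TensorProduct.assoc k V C _ (ρ.rTensor _ z)) := by
    intro z
    refine z.induction_on (by simp) (fun a b => ?_)
      (fun _ _ ha hb => by simp only [map_add, ha, hb])
    obtain ⟨S, hS⟩ := exists_finset (ρ a)
    simp [hS, sum_tmul]
  have e2 : (lEps C ∘ₗ incl (rhof f) (lamf f)).lTensor C ∘ₗ selfL f = incl (rhof f) (lamf f) :=
    LinearMap.ext (selfL_lEps f)
  rw [expand_spec, contract, incl_intoCot, LinearMap.comp_apply, e1, incl_cond,
    ← LinearMap.lTensor_comp_apply, e2]

end Raw

/-- Right comodules over the coalgebra `C`. -/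
structure RComod (k : Type u) [Field k] (C : Type v) [AddCommGroup C] [Module k C]
    [Coalgebra k C] where
  /-- the underlying vector space -/
  carrier : Type v
  [grp : AddCommGroup carrier]
  [mod : Module k carrier]
  /-- the coaction -/
  ρ : carrier →ₗ[k] carrier ⊗[k] C
  isCo : IsRightCoaction ρ

attribute [instance] RComod.grp RComod.mod

/-- Left comodules over the coalgebra `C`. -/
structure LComod (k : Type u) [Field k] (C : Type v) [AddCommGroup C] [Module k C]
    [Coalgebra k C] where
  /-- the underlying vector space -/
  carrier : Type v
  [grp : AddCommGroup carrier]
  [mod : Module k carrier]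
  /-- the coaction -/
  l : carrier →ₗ[k] C ⊗[k] carrier
  isCo : IsLeftCoaction l

attribute [instance] LComod.grp LComod.mod

/-- `(C, D)`-bicomodules. -/
structure Bicomod (k : Type u) [Field k] (C D : Type v) [AddCommGroup C] [Module k C]
    [Coalgebra k C] [AddCommGroup D] [Module k D] [Coalgebra k D] where
  /-- the underlying vector space -/
  carrier : Type v
  [grp : AddCommGroup carrier]
  [mod : Module k carrier]
  /-- the left coaction -/
  l : carrier →ₗ[k] C ⊗[k] carrier
  isCoL : IsLeftCoaction l
  /-- the right coaction -/
  ρ : carrier →ₗ[k] carrier ⊗[k] D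
  isCoR : IsRightCoaction ρ
  comm : Commutes l ρ

attribute [instance] Bicomod.grp Bicomod.mod

section Cats

variable {k : Type u} [Field k] {C D : Type v} [AddCommGroup C] [Module k C] [Coalgebra k C]
  [AddCommGroup D] [Module k D] [Coalgebra k D]

/-- Morphisms of right comodules: colinear maps. -/
@[ext]
structure RComod.Hom (V W : RComod k C) where
  /-- the underlying linear map -/
  lin : V.carrier →ₗ[k] W.carrier
  colin : RColinear V.ρ W.ρ lin

/-- The category `M^C` of right `C`-comodules. -/
instance : Category (RComod k C) where
  Hom := RComod.Hom
  id V := ⟨LinearMap.id, RColinear.id _⟩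
  comp g h := ⟨h.lin ∘ₗ g.lin, fun x => by
    rw [LinearMap.comp_apply, h.colin, g.colin, LinearMap.rTensor_comp_apply]⟩

@[ext]
theorem RComod.hom_ext {V W : RComod k C} {g h : V ⟶ W} (e : g.lin = h.lin) : g = h :=
  RComod.Hom.ext e

@[simp]
theorem RComod.id_lin (V : RComod k C) : RComod.Hom.lin (𝟙 V) = LinearMap.id := rfl

@[simp]
theorem RComod.comp_lin {U V W : RComod k C} (g : U ⟶ V) (h : V ⟶ W) :
    (g ≫ h).lin = h.lin ∘ₗ g.lin := rfl

/-- Unital associative algebras internal to the monoidal category of `C`-bicomodules, with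
`□_C` as tensor product and `C` as unit object. -/
structure IntAlg (k : Type u) [Field k] (C : Type v) [AddCommGroup C] [Module k C]
    [Coalgebra k C] where
  /-- the underlying bicomodule -/
  A : Bicomod k C C
  /-- the multiplication `A □_C A → A` -/
  mul : Cotensor A.ρ A.l →ₗ[k] A.carrier
  mul_left : LColinear (cotL A.ρ A.l A.l A.comm) A.l mul
  mul_right : RColinear (cotR A.ρ A.l A.ρ A.comm) A.ρ mul
  /-- the unit `C → A` -/
  one : C →ₗ[k] A.carrier
  one_left : LColinear Coalgebra.comul A.l one
  one_right : RColinear Coalgebra.comul A.ρ one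
  mul_assoc : ∀ x : Cotensor (cotR A.ρ A.l A.ρ A.comm) A.l,
    mul (cotMap mul LinearMap.id mul_right (LColinear.id _) x) =
      mul (cotMap LinearMap.id mul (RColinear.id _) mul_left (cotAssoc A.ρ A.l A.ρ A.comm A.l x))
  /-- the left unit law, through `ε ⊗ id : C □_C A ≅ A` -/
  one_mul : ∀ x : Cotensor (Coalgebra.comul (R := k) (A := C)) A.l,
    mul (cotMap one LinearMap.id one_right (LColinear.id _) x) = lEps A.carrier (incl _ _ x)
  /-- the right unit law, through `id ⊗ ε : A □_C C ≅ A` -/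
  mul_one : ∀ x : Cotensor A.ρ (Coalgebra.comul (R := k) (A := C)),
    mul (cotMap LinearMap.id one (RColinear.id _) one_left x) = rEps A.carrier (incl _ _ x)

/-- Right modules over an algebra `A` in `C`-bicomodules: right `C`-comodules `V` with an
associative and unital action `V □_C A → V` in right `C`-comodules. -/
structure RMod (A : IntAlg k C) where
  /-- the underlying comodule -/
  V : RComod k C
  /-- the action -/
  act : Cotensor V.ρ A.A.l →ₗ[k] V.carrier
  act_colin : RColinear (cotR V.ρ A.A.l A.A.ρ A.A.comm) V.ρ act
  act_assoc : ∀ x : Cotensor (cotR V.ρ A.A.l A.A.ρ A.A.comm) A.A.l,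
    act (cotMap act LinearMap.id act_colin (LColinear.id _) x) =
      act (cotMap LinearMap.id A.mul (RColinear.id _) A.mul_left
        (cotAssoc V.ρ A.A.l A.A.ρ A.A.comm A.A.l x))
  act_one : ∀ x : Cotensor V.ρ (Coalgebra.comul (R := k) (A := C)),
    act (cotMap LinearMap.id A.one (RColinear.id _) A.one_left x) = rEps V.carrier (incl _ _ x)

/-- Morphisms of right modules: comodule maps commuting with the actions. -/
@[ext]
structure RMod.Hom {A : IntAlg k C} (M N : RMod A) where
  /-- the underlying comodule map -/
  hom : M.V ⟶ N.V
  equivariant : ∀ x : Cotensor M.V.ρ A.A.l,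
    hom.lin (M.act x) = N.act (cotMap hom.lin LinearMap.id hom.colin (LColinear.id _) x)

/-- The category `M_A` of right `A`-modules. -/
instance (A : IntAlg k C) : Category (RMod A) where
  Hom := RMod.Hom
  id M := ⟨𝟙 _, fun x => by
    apply congrArg M.act
    apply incl_injective
    simp⟩
  comp g h := ⟨g.hom ≫ h.hom, fun x => by
    change h.hom.lin (g.hom.lin _) = _
    rw [g.equivariant, h.equivariant]
    congr 1
    apply incl_injective
    simp only [coe_cotMap, RComod.comp_lin, TensorProduct.map_map, LinearMap.id_comp]⟩

@[ext]
theorem RMod.hom_ext {A : IntAlg k C} {M N : RMod A} {g h : M ⟶ N}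
    (e : g.hom.lin = h.hom.lin) : g = h :=
  RMod.Hom.ext (RComod.hom_ext e)

@[simp]
theorem RMod.id_hom {A : IntAlg k C} (M : RMod A) : RMod.Hom.hom (𝟙 M) = 𝟙 M.V := rfl

@[simp]
theorem RMod.comp_hom {A : IntAlg k C} {L M N : RMod A} (g : L ⟶ M) (h : M ⟶ N) :
    (g ≫ h).hom = g.hom ≫ h.hom := rfl

/-- `C □_D C` as an algebra in `C`-bicomodules. -/
def selfAlg (f : C →ₗc[k] D) : IntAlg k C where
  A :=
    { carrier := Cotensor (rhof f) (lamf f)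
      l := selfL f
      isCoL := cotL_isLeftCoaction _ _ _ _ comul_isLeftCoaction
      ρ := cotC f (rhof f)
      isCoR := cotR_isRightCoaction _ _ _ _ comul_isRightCoaction
      comm := self_commutes f }
  mul := cotAct f (rhof f)
  mul_left := cotAct_lColinear f (rhof f) Coalgebra.comul (rhof_commutes f)
  mul_right := cotAct_rColinear f (rhof f)
  one := selfUnit f
  one_left := selfUnit_lColinear f
  one_right := unitMap_rColinear f _ comul_isRightCoaction
  mul_assoc := cotAct_assoc f (rhof f)
  one_mul := cotAct_unit_left f
  mul_one := cotAct_unit f (rhof f)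

/-- The right `C`-comodule `W □_D C`. -/
def cotComod (f : C →ₗc[k] D) (W : RComod k D) : RComod k C where
  carrier := Cotensor W.ρ (lamf f)
  ρ := cotC f W.ρ
  isCo := cotR_isRightCoaction _ _ _ _ comul_isRightCoaction

/-- The right `C □_D C`-module `W □_D C`. -/
def cotMod (f : C →ₗc[k] D) (W : RComod k D) : RMod (selfAlg f) where
  V := cotComod f W
  act := cotAct f W.ρ
  act_colin := cotAct_rColinear f W.ρ
  act_assoc := cotAct_assoc f W.ρ
  act_one := cotAct_unit f W.ρ

theorem cotMap_cotC (f : C →ₗc[k] D) {W W' : RComod k D} (g : W ⟶ W') :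
    RColinear (cotC f W.ρ) (cotC f W'.ρ)
      (cotMap g.lin LinearMap.id g.colin (LColinear.id (lamf f))) := by
  intro x
  apply rTensor_inj _ (incl_injective _ _)
  have e1 : ∀ z, (incl W'.ρ (lamf f)).rTensor C
      ((cotMap g.lin LinearMap.id g.colin (LColinear.id (lamf f))).rTensor C z) =
      (TensorProduct.map g.lin LinearMap.id).rTensor C ((incl W.ρ (lamf f)).rTensor C z) := by
    intro z
    refine z.induction_on (by simp) (fun a b => ?_)
      (fun _ _ ha hb => by simp only [map_add, ha, hb])
    simp
  rw [e1, cotR_spec, cotR_spec, coe_cotMap]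
  generalize incl W.ρ (lamf f) x = z
  refine z.induction_on (by simp) (fun a b => ?_)
    (fun _ _ ha hb => by simp only [map_add, ha, hb])
  obtain ⟨S, hS⟩ := exists_finset (Coalgebra.comul (R := k) (A := C) b)
  simp [hS, tmul_sum]

theorem cotMap_equivariant (f : C →ₗc[k] D) {W W' : RComod k D} (g : W ⟶ W')
    (x : Cotensor (cotC f W.ρ) (selfL f)) :
    cotMap g.lin LinearMap.id g.colin (LColinear.id _) (cotAct f W.ρ x) =
      cotAct f W'.ρ (cotMap (cotMap g.lin LinearMap.id g.colin (LColinear.id _)) LinearMap.id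
        (cotMap_cotC f g) (LColinear.id _) x) := by
  apply incl_injective W'.ρ (lamf f)
  have e0 : ∀ z : W.carrier ⊗[k] C, rEps (k := k) W'.carrier
      (TensorProduct.map g.lin LinearMap.id z) = g.lin (rEps W.carrier z) := by
    intro z
    refine z.induction_on (by simp) (fun a b => ?_)
      (fun _ _ ha hb => by simp only [map_add, ha, hb])
    simp
  rw [cotAct_spec, coe_cotMap, coe_cotMap, cotAct_spec]
  generalize incl (cotC f W.ρ) (selfL f) x = z
  refine z.induction_on (by simp) (fun a b => ?_)
    (fun _ _ ha hb => by simp only [map_add, ha, hb])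
  simp [e0]

/-- The functor `- □_D C : M^D → M_{C □_D C}`. -/
def cotFunctor (f : C →ₗc[k] D) : RComod k D ⥤ RMod (selfAlg f) where
  obj W := cotMod f W
  map {W W'} g :=
    { hom := ⟨cotMap g.lin LinearMap.id g.colin (LColinear.id _), cotMap_cotC f g⟩
      equivariant := cotMap_equivariant f g }
  map_id W := by
    apply RMod.hom_ext
    apply LinearMap.ext
    intro x
    apply incl_injective W.ρ (lamf f)
    change TensorProduct.map LinearMap.id LinearMap.id (incl W.ρ (lamf f) x) =
      incl W.ρ (lamf f) x
    rw [TensorProduct.map_id, LinearMap.id_apply]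
  map_comp {U V W} g h := by
    apply RMod.hom_ext
    apply LinearMap.ext
    intro x
    apply incl_injective W.ρ (lamf f)
    change TensorProduct.map (h.lin ∘ₗ g.lin) LinearMap.id (incl U.ρ (lamf f) x) =
      TensorProduct.map h.lin LinearMap.id (TensorProduct.map g.lin LinearMap.id
        (incl U.ρ (lamf f) x))
    simp only [TensorProduct.map_map, LinearMap.id_comp]

/-- The action of a right `C □_D C`-module `N`. -/
def selfAct (f : C →ₗc[k] D) (N : RMod (selfAlg f)) :
    Cotensor N.V.ρ (selfL f) →ₗ[k] N.V.carrier :=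
  N.act

theorem selfAct_rColinear (f : C →ₗc[k] D) (N : RMod (selfAlg f)) :
    RColinear (cotR N.V.ρ (selfL f) (cotC f (rhof f)) (self_commutes f)) N.V.ρ (selfAct f N) :=
  N.act_colin

theorem selfAct_natural (f : C →ₗc[k] D) {M N : RMod (selfAlg f)} (g : M ⟶ N)
    (x : Cotensor M.V.ρ (selfL f)) : g.hom.lin (selfAct f M x) =
      selfAct f N (cotMap g.hom.lin LinearMap.id g.hom.colin (LColinear.id _) x) :=
  g.equivariant x

/-- The action of a right `C □_D C`-module `N`, as a map `N □_D C ≅ N □_C (C □_D C) → N`. -/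
def actD (f : C →ₗc[k] D) (N : RMod (selfAlg f)) :
    Cotensor (corestR f N.V.ρ) (lamf f) →ₗ[k] N.V.carrier :=
  selfAct f N ∘ₗ expand f N.V.ρ N.V.isCo

/-- The map `id ⊗ ε : N □_D C → N`. -/
def epsD (f : C →ₗc[k] D) (N : RMod (selfAlg f)) :
    Cotensor (corestR f N.V.ρ) (lamf f) →ₗ[k] N.V.carrier :=
  rEps N.V.carrier ∘ₗ incl (corestR f N.V.ρ) (lamf f)

/-- The space of coinvariants of `N`: the coequalizer of `actD` and `epsD`. -/
abbrev CoinvSpace (f : C →ₗc[k] D) (N : RMod (selfAlg f)) : Type v :=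
  N.V.carrier ⧸ LinearMap.range (actD f N - epsD f N)

/-- The projection onto the coinvariants. -/
abbrev toCoinv (f : C →ₗc[k] D) (N : RMod (selfAlg f)) : N.V.carrier →ₗ[k] CoinvSpace f N :=
  (LinearMap.range (actD f N - epsD f N)).mkQ

theorem toCoinv_eq (f : C →ₗc[k] D) (N : RMod (selfAlg f))
    (z : Cotensor (corestR f N.V.ρ) (lamf f)) :
    toCoinv f N (actD f N z) = toCoinv f N (epsD f N z) := by
  rw [← sub_eq_zero, ← map_sub]
  simp only [toCoinv, Submodule.mkQ_apply]
  rw [Submodule.Quotient.mk_eq_zero]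
  exact ⟨z, rfl⟩

theorem rl_comm {V V' X Y : Type*} [AddCommGroup V] [Module k V] [AddCommGroup V'] [Module k V']
    [AddCommGroup X] [Module k X] [AddCommGroup Y] [Module k Y] (g : V →ₗ[k] V') (h : X →ₗ[k] Y)
    (z : V ⊗[k] X) : g.rTensor Y (h.lTensor V z) = h.lTensor V' (g.rTensor X z) := by
  rw [← LinearMap.comp_apply, ← LinearMap.comp_apply, LinearMap.lTensor_comp_rTensor,
    LinearMap.rTensor_comp_lTensor]

/-- `C`-colinearity implies `D`-colinearity of the corestrictions. -/
theorem RColinear.corestR (f : C →ₗc[k] D) {V V' : Type v} [AddCommGroup V] [Module k V]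
    [AddCommGroup V'] [Module k V'] {ρ : V →ₗ[k] V ⊗[k] C} {ρ' : V' →ₗ[k] V' ⊗[k] C}
    {g : V →ₗ[k] V'} (h : RColinear ρ ρ' g) : RColinear (corestR f ρ) (corestR f ρ') g := by
  intro x
  change (f : C →ₗ[k] D).lTensor V' (ρ' (g x)) = g.rTensor D ((f : C →ₗ[k] D).lTensor V (ρ x))
  rw [h, rl_comm]

theorem expand_rColinear (f : C →ₗc[k] D) {V : Type v} [AddCommGroup V] [Module k V]
    (ρ : V →ₗ[k] V ⊗[k] C) (hρ : IsRightCoaction ρ) :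
    RColinear (cotC f (CoalgDescent.corestR f ρ))
      (cotR ρ (selfL f) (cotC f (rhof f)) (self_commutes f)) (expand f ρ hρ) := by
  intro x
  apply rTensor_inj _ (incl_injective _ _)
  apply rTensor_inj _ (lTensor_inj _ (incl_injective _ _))
  have e1 : ∀ z, ((incl (rhof f) (lamf f)).lTensor V).rTensor C
      ((incl ρ (selfL f)).rTensor C ((expand f ρ hρ).rTensor C z)) =
      ((TensorProduct.assoc k V C C).toLinearMap ∘ₗ ρ.rTensor C).rTensor C
        ((incl _ _).rTensor C z) := by
    intro z
    refine z.induction_on (by simp) (fun a b => ?_)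
      (fun _ _ ha hb => by simp only [map_add, ha, hb])
    simp [expand_spec]
  have e2 : ∀ z, ((incl (rhof f) (lamf f)).lTensor V).rTensor C
      ((TensorProduct.assoc k V _ C).symm ((cotC f (rhof f)).lTensor V z)) =
      (TensorProduct.assoc k V _ C).symm (((TensorProduct.assoc k C C C).symm.toLinearMap ∘ₗ
        (Coalgebra.comul (R := k) (A := C)).lTensor C).lTensor V
          ((incl (rhof f) (lamf f)).lTensor V z)) := by
    intro z
    refine z.induction_on (by simp) (fun a b => ?_)
      (fun _ _ ha hb => by simp only [map_add, ha, hb])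
    have e3 : ∀ t, ((incl (rhof f) (lamf f)).lTensor V).rTensor C
        ((TensorProduct.assoc k V _ C).symm (a ⊗ₜ[k] t)) =
        (TensorProduct.assoc k V _ C).symm (a ⊗ₜ[k] (incl (rhof f) (lamf f)).rTensor C t) := by
      intro t
      refine t.induction_on (by simp) (fun a b => ?_)
        (fun _ _ ha hb => by simp only [map_add, tmul_add, ha, hb])
      simp
    simp only [LinearMap.lTensor_tmul]
    rw [e3, cotR_spec]
    rfl
  rw [e1, cotR_spec, cotR_spec, e2, expand_spec]
  generalize incl (CoalgDescent.corestR f ρ) (lamf f) x = z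
  refine z.induction_on (by simp) (fun a b => ?_)
    (fun _ _ ha hb => by simp only [map_add, ha, hb])
  obtain ⟨S, hS⟩ := exists_finset (Coalgebra.comul (R := k) (A := C) b)
  obtain ⟨T, hT⟩ := exists_finset (ρ a)
  simp only [hS, hT, map_sum, sum_tmul, tmul_sum, LinearMap.rTensor_tmul,
    LinearMap.lTensor_tmul, TensorProduct.assoc_tmul, TensorProduct.assoc_symm_tmul,
    LinearEquiv.coe_coe, LinearMap.comp_apply]
  first | done | exact Finset.sum_comm

theorem actD_rColinear (f : C →ₗc[k] D) (N : RMod (selfAlg f)) :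
    RColinear (cotC f (corestR f N.V.ρ)) N.V.ρ (actD f N) := by
  intro x
  rw [actD, LinearMap.rTensor_comp_apply, ← expand_rColinear f N.V.ρ N.V.isCo x,
    LinearMap.comp_apply, selfAct_rColinear]

theorem epsD_rColinear (f : C →ₗc[k] D) (N : RMod (selfAlg f)) :
    RColinear (corestR f (cotC f (corestR f N.V.ρ))) (corestR f N.V.ρ) (epsD f N) := by
  intro x
  change corestR f N.V.ρ (rEps _ (incl _ _ x)) = (rEps _ ∘ₗ incl _ _).rTensor D
    ((f : C →ₗ[k] D).lTensor _ (cotC f (corestR f N.V.ρ) x))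
  rw [coact_rEps, rl_comm, LinearMap.rTensor_comp_apply, cotR_spec, rEps_comul]

/-- The right `D`-coaction on the coinvariants, induced by that on `N`. -/
def coinvCoact (f : C →ₗc[k] D) (N : RMod (selfAlg f)) :
    CoinvSpace f N →ₗ[k] CoinvSpace f N ⊗[k] D :=
  (LinearMap.range (actD f N - epsD f N)).liftQ
    ((toCoinv f N).rTensor D ∘ₗ corestR f N.V.ρ) (by
      rintro _ ⟨z, rfl⟩
      rw [LinearMap.mem_ker, LinearMap.sub_apply, map_sub, sub_eq_zero, LinearMap.comp_apply,
        LinearMap.comp_apply, (actD_rColinear f N).corestR f, epsD_rColinear,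
        ← LinearMap.rTensor_comp_apply, ← LinearMap.rTensor_comp_apply]
      congr 2
      exact LinearMap.ext (toCoinv_eq f N))

theorem toCoinv_rColinear (f : C →ₗc[k] D) (N : RMod (selfAlg f)) :
    RColinear (corestR f N.V.ρ) (coinvCoact f N) (toCoinv f N) :=
  fun _ => rfl

/-- The right `D`-comodule of coinvariants. -/
def coinvComod (f : C →ₗc[k] D) (N : RMod (selfAlg f)) : RComod k D where
  carrier := CoinvSpace f N
  ρ := coinvCoact f N
  isCo :=
    { coassoc := fun x => by
        obtain ⟨n, rfl⟩ := Submodule.mkQ_surjective _ x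
        have h := (corestR_isRightCoaction f N.V.isCo).coassoc n
        have h1 := congrArg ((toCoinv f N).rTensor (D ⊗[k] D)) h
        have e1 : ∀ z, TensorProduct.assoc k _ D D ((coinvCoact f N).rTensor D
            ((toCoinv f N).rTensor D z)) = (toCoinv f N).rTensor (D ⊗[k] D)
              (TensorProduct.assoc k _ D D ((corestR f N.V.ρ).rTensor D z)) := by
          intro z
          refine z.induction_on (by simp) (fun a b => ?_)
            (fun _ _ ha hb => by simp only [map_add, ha, hb])
          simp only [LinearMap.rTensor_tmul]
          rw [toCoinv_rColinear, natR]
        rw [toCoinv_rColinear, e1, h1, rl_comm]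
      counit := fun x => by
        obtain ⟨n, rfl⟩ := Submodule.mkQ_surjective _ x
        have h := (corestR_isRightCoaction f N.V.isCo).counit n
        rw [toCoinv_rColinear, ← rl_comm, h, LinearMap.rTensor_tmul] }

theorem actD_natural (f : C →ₗc[k] D) {M N : RMod (selfAlg f)} (g : M ⟶ N)
    (z : Cotensor (corestR f M.V.ρ) (lamf f)) :
    g.hom.lin (actD f M z) = actD f N
      (cotMap g.hom.lin LinearMap.id (g.hom.colin.corestR f) (LColinear.id _) z) := by
  rw [actD, actD, LinearMap.comp_apply, LinearMap.comp_apply, selfAct_natural]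
  apply congrArg (selfAct f N)
  apply incl_injective
  apply lTensor_inj _ (incl_injective (rhof f) (lamf f))
  rw [expand_spec, coe_cotMap, coe_cotMap]
  have e1 : ∀ t, (incl (rhof f) (lamf f)).lTensor N.V.carrier
      (TensorProduct.map g.hom.lin LinearMap.id t) =
      g.hom.lin.rTensor _ ((incl (rhof f) (lamf f)).lTensor M.V.carrier t) := by
    intro t
    refine t.induction_on (by simp) (fun a b => ?_)
      (fun _ _ ha hb => by simp only [map_add, ha, hb])
    simp
  rw [e1, expand_spec]
  generalize incl (corestR f M.V.ρ) (lamf f) z = t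
  refine t.induction_on (by simp) (fun a b => ?_)
    (fun _ _ ha hb => by simp only [map_add, ha, hb])
  have := g.hom.colin a
  simp only [LinearMap.rTensor_tmul, TensorProduct.map_tmul, this, natR, LinearMap.id_apply]

theorem epsD_natural (f : C →ₗc[k] D) {M N : RMod (selfAlg f)} (g : M ⟶ N)
    (z : Cotensor (corestR f M.V.ρ) (lamf f)) :
    g.hom.lin (epsD f M z) = epsD f N
      (cotMap g.hom.lin LinearMap.id (g.hom.colin.corestR f) (LColinear.id _) z) := by
  change g.hom.lin (rEps _ (incl _ _ z)) = rEps _ (incl _ _ _)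
  rw [coe_cotMap]
  generalize incl (corestR f M.V.ρ) (lamf f) z = t
  refine t.induction_on (by simp) (fun a b => ?_)
    (fun _ _ ha hb => by simp only [map_add, ha, hb])
  simp

/-- The map induced on coinvariants. -/
def coinvMap (f : C →ₗc[k] D) {M N : RMod (selfAlg f)} (g : M ⟶ N) :
    CoinvSpace f M →ₗ[k] CoinvSpace f N :=
  (LinearMap.range (actD f M - epsD f M)).liftQ (toCoinv f N ∘ₗ g.hom.lin) (by
    rintro _ ⟨z, rfl⟩
    rw [LinearMap.mem_ker, LinearMap.sub_apply, map_sub, sub_eq_zero, LinearMap.comp_apply,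
      LinearMap.comp_apply, actD_natural, epsD_natural, toCoinv_eq])

theorem coinvMap_toCoinv (f : C →ₗc[k] D) {M N : RMod (selfAlg f)} (g : M ⟶ N)
    (n : M.V.carrier) : coinvMap f g (toCoinv f M n) = toCoinv f N (g.hom.lin n) := rfl

theorem coinvMap_rColinear (f : C →ₗc[k] D) {M N : RMod (selfAlg f)} (g : M ⟶ N) :
    RColinear (coinvCoact f M) (coinvCoact f N) (coinvMap f g) := by
  intro x
  obtain ⟨n, rfl⟩ := Submodule.mkQ_surjective _ x
  have e : coinvMap f g ∘ₗ toCoinv f M = toCoinv f N ∘ₗ g.hom.lin := rfl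
  rw [coinvMap_toCoinv, toCoinv_rColinear, toCoinv_rColinear, g.hom.colin.corestR f,
    ← LinearMap.rTensor_comp_apply, ← LinearMap.rTensor_comp_apply, e]

/-- The functor of coinvariants `M_{C □_D C} → M^D`. -/
def coinvFunctor (f : C →ₗc[k] D) : RMod (selfAlg f) ⥤ RComod k D where
  obj N := coinvComod f N
  map g := ⟨coinvMap f g, coinvMap_rColinear f g⟩
  map_id N := by
    apply RComod.hom_ext
    apply LinearMap.ext
    intro x
    obtain ⟨n, rfl⟩ := Submodule.mkQ_surjective _ x
    rfl
  map_comp g h := by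
    apply RComod.hom_ext
    apply LinearMap.ext
    intro x
    obtain ⟨n, rfl⟩ := Submodule.mkQ_surjective _ x
    rfl

/-- The unit `N → N_{C □_D C} □_D C`, `n ↦ [n₀] ⊗ n₁`. -/
def adjUnitLin (f : C →ₗc[k] D) (N : RMod (selfAlg f)) :
    N.V.carrier →ₗ[k] Cotensor (coinvCoact f N) (lamf f) :=
  cotMap (toCoinv f N) LinearMap.id (toCoinv_rColinear f N) (LColinear.id _) ∘ₗ
    unitMap f N.V.ρ N.V.isCo

theorem adjUnitLin_spec (f : C →ₗc[k] D) (N : RMod (selfAlg f)) (n : N.V.carrier) :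
    incl _ _ (adjUnitLin f N n) = (toCoinv f N).rTensor C (N.V.ρ n) := rfl

theorem adjUnitLin_rColinear (f : C →ₗc[k] D) (N : RMod (selfAlg f)) :
    RColinear N.V.ρ (cotC f (coinvCoact f N)) (adjUnitLin f N) := by
  intro n
  apply rTensor_inj _ (incl_injective _ _)
  rw [cotR_spec, adjUnitLin_spec, ← LinearMap.rTensor_comp_apply]
  change _ = ((toCoinv f N).rTensor C ∘ₗ N.V.ρ).rTensor C _
  rw [LinearMap.rTensor_comp_apply, ← rl_comm, ← N.V.isCo.coassoc]
  generalize N.V.ρ.rTensor C (N.V.ρ n) = t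
  refine t.induction_on (by simp) (fun a b => ?_)
    (fun _ _ ha hb => by simp only [map_add, ha, hb])
  rw [natR, LinearEquiv.symm_apply_apply, LinearMap.rTensor_tmul]

theorem adjUnitLin_equivariant (f : C →ₗc[k] D) (N : RMod (selfAlg f))
    (y : Cotensor N.V.ρ (selfL f)) :
    adjUnitLin f N (selfAct f N y) = cotAct f (coinvCoact f N)
      (cotMap (adjUnitLin f N) LinearMap.id (adjUnitLin_rColinear f N) (LColinear.id _) y) := by
  apply incl_injective
  let s : N.V.carrier ⊗[k] Cotensor (rhof f) (lamf f) →ₗ[k] N.V.carrier :=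
    rEps (C := C) N.V.carrier ∘ₗ (lEps C ∘ₗ incl (rhof f) (lamf f)).lTensor N.V.carrier
  have e1 : ∀ y : Cotensor N.V.ρ (selfL f),
      toCoinv f N (selfAct f N y) = toCoinv f N (s (incl _ _ y)) := by
    intro y
    have h := toCoinv_eq f N (contract f N.V.ρ y)
    rw [show actD f N (contract f N.V.ρ y) =
      selfAct f N (expand f N.V.ρ N.V.isCo (contract f N.V.ρ y)) from rfl, expand_contract] at h
    exact h
  have h1 : N.V.ρ (selfAct f N y) = (selfAct f N).rTensor C
      (cotR N.V.ρ (selfL f) (cotC f (rhof f)) (self_commutes f) y) := selfAct_rColinear f N y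
  have e2 : toCoinv f N ∘ₗ selfAct f N = (toCoinv f N ∘ₗ s) ∘ₗ incl N.V.ρ (selfL f) :=
    LinearMap.ext e1
  have e3 : (toCoinv f N).rTensor C ((selfAct f N).rTensor C
      (cotR N.V.ρ (selfL f) (cotC f (rhof f)) (self_commutes f) y)) =
      (toCoinv f N ∘ₗ s).rTensor C ((incl N.V.ρ (selfL f)).rTensor C
        (cotR N.V.ρ (selfL f) (cotC f (rhof f)) (self_commutes f) y)) := by
    rw [← LinearMap.rTensor_comp_apply, ← LinearMap.rTensor_comp_apply]
    exact congrArg (fun g => LinearMap.rTensor C g _) e2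
  rw [adjUnitLin_spec, h1, e3, cotR_spec, cotAct_spec, coe_cotMap]
  generalize incl N.V.ρ (selfL f) y = z
  refine z.induction_on (by simp) (fun a b => ?_)
    (fun _ _ ha hb => by simp only [map_add, ha, hb])
  have e4 : rEps (k := k) (C := C) _ (incl _ _ (adjUnitLin f N a)) = toCoinv f N a := by
    have h0 := congrArg (toCoinv f N) (N.V.isCo.rEps a)
    rw [adjUnitLin_spec, ← h0]
    generalize N.V.ρ a = t
    refine t.induction_on (by simp) (fun a b => ?_)
      (fun _ _ ha hb => by simp only [map_add, ha, hb])
    simp only [LinearMap.rTensor_tmul, rEps_tmul, map_smul]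
  have e5 : lEps (k := k) (C := C) C ((lEps C ∘ₗ incl (rhof f) (lamf f)).rTensor C
      (cotC f (rhof f) b)) = lEps C (incl (rhof f) (lamf f) b) := by
    rw [← comul_lEps]
    simp [lEps]
  simp only [TensorProduct.map_tmul, LinearMap.comp_apply, LinearMap.id_apply,
    LinearMap.lTensor_tmul]
  rw [e4, ← e5]
  generalize cotC f (rhof f) b = t
  refine t.induction_on (by simp) (fun a b => ?_)
    (fun _ _ ha hb => by simp only [map_add, tmul_add, ha, hb])
  simp [s, smul_tmul]

theorem rEps_cotAct_expand (f : C →ₗc[k] D) {W : Type v} [AddCommGroup W] [Module k W]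
    (ρ : W →ₗ[k] W ⊗[k] D) (hρ : IsRightCoaction (cotC f ρ))
    (z : Cotensor (corestR f (cotC f ρ)) (lamf f)) :
    rEps W (incl ρ (lamf f) (cotAct f ρ (expand f (cotC f ρ) hρ z))) =
      rEps W (incl ρ (lamf f) (rEps _ (incl _ _ z))) := by
  have h := expand_spec f (cotC f ρ) hρ z
  have e1 : ∀ t, TensorProduct.map (rEps W ∘ₗ incl ρ (lamf f))
      (lEps (k := k) (C := C) C ∘ₗ incl (rhof f) (lamf f)) t =
      TensorProduct.map (rEps W ∘ₗ incl ρ (lamf f)) (lEps (k := k) (C := C) C)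
        ((incl (rhof f) (lamf f)).lTensor _ t) := by
    intro t
    refine t.induction_on (by simp) (fun a b => ?_)
      (fun _ _ ha hb => by simp only [map_add, ha, hb])
    simp
  rw [cotAct_spec, e1, h]
  generalize incl (corestR f (cotC f ρ)) (lamf f) z = t
  refine t.induction_on (by simp) (fun a b => ?_)
    (fun _ _ ha hb => by simp only [map_add, ha, hb])
  have h0 := congrArg (fun t => Coalgebra.counit (R := k) b •
    rEps W (incl ρ (lamf f) t)) (hρ.rEps a)
  simp only [LinearMap.rTensor_tmul, rEps_tmul, map_smul] at h0 ⊢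
  rw [← h0]
  generalize cotC f ρ a = t
  refine t.induction_on (by simp) (fun a c => ?_)
    (fun _ _ ha hb => by simp only [map_add, add_tmul, smul_add, ha, hb])
  simp [smul_smul, mul_comm]

/-- The counit `(W □_D C)_{C □_D C} → W`, `[w ⊗ c] ↦ ε(c) w`. -/
def adjCounitLin (f : C →ₗc[k] D) (W : RComod k D) :
    CoinvSpace f (cotMod f W) →ₗ[k] W.carrier :=
  (LinearMap.range (actD f (cotMod f W) - epsD f (cotMod f W))).liftQ
    (rEps W.carrier ∘ₗ incl W.ρ (lamf f)) (by
      rintro _ ⟨z, rfl⟩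
      rw [LinearMap.mem_ker, LinearMap.sub_apply, map_sub, sub_eq_zero]
      exact rEps_cotAct_expand f W.ρ (cotComod f W).isCo z)

theorem adjCounitLin_spec (f : C →ₗc[k] D) (W : RComod k D) (y : Cotensor W.ρ (lamf f)) :
    adjCounitLin f W (toCoinv f (cotMod f W) y) = rEps W.carrier (incl W.ρ (lamf f) y) := rfl

theorem adjCounitLin_rColinear (f : C →ₗc[k] D) (W : RComod k D) :
    RColinear (coinvCoact f (cotMod f W)) W.ρ (adjCounitLin f W) := by
  intro x
  obtain ⟨y, rfl⟩ := Submodule.mkQ_surjective _ x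
  have h : ∀ y : Cotensor W.ρ (lamf f), W.ρ (rEps W.carrier (incl W.ρ (lamf f) y)) =
      (rEps W.carrier ∘ₗ incl W.ρ (lamf f)).rTensor D
        ((f : C →ₗ[k] D).lTensor _ (cotC f W.ρ y)) := by
    intro y
    rw [coact_rEps, rl_comm, LinearMap.rTensor_comp_apply, cotR_spec, rEps_comul]
  exact (h y).trans (LinearMap.rTensor_comp_apply D (adjCounitLin f W)
    (toCoinv f (cotMod f W)) _)

/-- The adjunction between coinvariants and `- □_D C`. -/
def descentAdj (f : C →ₗc[k] D) : coinvFunctor f ⊣ cotFunctor f :=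
  Adjunction.mkOfUnitCounit
    { unit :=
        { app := fun N =>
            { hom := ⟨adjUnitLin f N, adjUnitLin_rColinear f N⟩
              equivariant := adjUnitLin_equivariant f N }
          naturality := fun M N g => by
            apply RMod.hom_ext
            apply LinearMap.ext
            intro x
            apply incl_injective (coinvCoact f N) (lamf f)
            change (toCoinv f N).rTensor C (N.V.ρ (g.hom.lin x)) =
              TensorProduct.map (coinvMap f g) LinearMap.id
                ((toCoinv f M).rTensor C (M.V.ρ x))
            rw [g.hom.colin]
            generalize M.V.ρ x = t
            refine t.induction_on (by simp) (fun a b => ?_)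
              (fun _ _ ha hb => by simp only [map_add, ha, hb])
            rfl }
      counit :=
        { app := fun W => ⟨adjCounitLin f W, adjCounitLin_rColinear f W⟩
          naturality := fun W W' g => by
            apply RComod.hom_ext
            apply LinearMap.ext
            intro x
            obtain ⟨y, rfl⟩ := Submodule.mkQ_surjective _ x
            change rEps W'.carrier (TensorProduct.map g.lin LinearMap.id (incl W.ρ (lamf f) y)) =
              g.lin (rEps W.carrier (incl W.ρ (lamf f) y))
            generalize incl W.ρ (lamf f) y = t
            refine t.induction_on (by simp) (fun a b => ?_)
              (fun _ _ ha hb => by simp only [map_add, ha, hb])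
            simp }
      left_triangle := by
        ext N : 2
        apply RComod.hom_ext
        apply LinearMap.ext
        intro x
        obtain ⟨n, rfl⟩ := Submodule.mkQ_surjective _ x
        change rEps _ ((toCoinv f N).rTensor C (N.V.ρ n)) = toCoinv f N n
        have h0 := congrArg (toCoinv f N) (N.V.isCo.rEps n)
        rw [← h0]
        generalize N.V.ρ n = t
        refine t.induction_on (by simp) (fun a b => ?_)
          (fun _ _ ha hb => by simp only [map_add, ha, hb])
        simp only [LinearMap.rTensor_tmul, rEps_tmul, map_smul]
      right_triangle := by
        ext W : 2
        apply RMod.hom_ext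
        apply LinearMap.ext
        intro y
        apply incl_injective W.ρ (lamf f)
        change TensorProduct.map (adjCounitLin f W) LinearMap.id
          ((toCoinv f (cotMod f W)).rTensor C (cotC f W.ρ y)) = incl W.ρ (lamf f) y
        have h : ∀ y : Cotensor W.ρ (lamf f),
            (rEps W.carrier ∘ₗ incl W.ρ (lamf f)).rTensor C (cotC f W.ρ y) =
              incl W.ρ (lamf f) y := by
          intro y
          rw [LinearMap.rTensor_comp_apply, cotR_spec, rEps_comul]
        exact (LinearMap.rTensor_comp_apply C (adjCounitLin f W)
          (toCoinv f (cotMod f W)) _).symm.trans (h y) }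

/-- The functor `- □_C M : M^C → Vec` for a left `C`-comodule `M`. -/
def cotVec (M : LComod k C) : RComod k C ⥤ ModuleCat.{v} k where
  obj V := ModuleCat.of k (Cotensor V.ρ M.l)
  map g := ModuleCat.ofHom (cotMap g.lin LinearMap.id g.colin (LColinear.id _))
  map_id V := by
    apply ModuleCat.hom_ext
    apply LinearMap.ext
    intro x
    apply incl_injective V.ρ M.l
    change TensorProduct.map LinearMap.id LinearMap.id (incl V.ρ M.l x) = incl V.ρ M.l x
    rw [TensorProduct.map_id, LinearMap.id_apply]
  map_comp {U V W} g h := by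
    apply ModuleCat.hom_ext
    apply LinearMap.ext
    intro x
    apply incl_injective W.ρ M.l
    change TensorProduct.map (h.lin ∘ₗ g.lin) LinearMap.id (incl U.ρ M.l x) =
      TensorProduct.map h.lin LinearMap.id (TensorProduct.map g.lin LinearMap.id
        (incl U.ρ M.l x))
    simp only [TensorProduct.map_map, LinearMap.id_comp]

/-- A left `C`-comodule `M` is coflat if `- □_C M : M^C → Vec` is exact, that is, takes short
exact sequences to short exact sequences. Kernels and cokernels of comodules over a field are
those of the underlying vector spaces. -/
def LComod.IsCoflat (M : LComod k C) : Prop :=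
  ∀ (X Y Z : RComod k C) (i : X ⟶ Y) (p : Y ⟶ Z), Function.Injective i.lin →
    Function.Exact i.lin p.lin → Function.Surjective p.lin →
      Function.Injective ((cotVec M).map i).hom ∧
      Function.Exact ((cotVec M).map i).hom ((cotVec M).map p).hom ∧
      Function.Surjective ((cotVec M).map p).hom

/-- A left `C`-comodule `M` is faithfully coflat if `- □_C M` is exact and faithful. -/
def LComod.IsFaithfullyCoflat (M : LComod k C) : Prop :=
  M.IsCoflat ∧ (cotVec M).Faithful

/-- `C` as a left `D`-comodule along `f`. -/
def leftComodOf (f : C →ₗc[k] D) : LComod k D where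
  carrier := C
  l := lamf f
  isCo := corestL_isLeftCoaction f comul_isLeftCoaction

/-- A coalgebra morphism `f : C → D` is left faithfully coflat if `C` is so as a left
`D`-comodule. -/
def LeftFaithfullyCoflat (f : C →ₗc[k] D) : Prop := (leftComodOf f).IsFaithfullyCoflat

/-- `f : C → D` has a right inverse in `D`-bicomodules. -/
def SplitsInBicomodules (f : C →ₗc[k] D) : Prop :=
  ∃ s : D →ₗ[k] C, LColinear Coalgebra.comul (lamf f) s ∧ RColinear Coalgebra.comul (rhof f) s ∧
    (f : C →ₗ[k] D) ∘ₗ s = LinearMap.id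

end Cats

end

end CoalgDescent

namespace CoalgDescent

noncomputable section

variable {k : Type u} [Field k] {C D : Type v} [AddCommGroup C] [Module k C] [Coalgebra k C]
  [AddCommGroup D] [Module k D]

section Comodules

variable {V V' V'' : Type v} [AddCommGroup V] [Module k V] [AddCommGroup V'] [Module k V']
  [AddCommGroup V''] [Module k V'']

theorem assoc_rTensor_rTensor {g : V →ₗ[k] V'} {ρ : V →ₗ[k] V ⊗[k] D} {ρ' : V' →ₗ[k] V' ⊗[k] D}
    (hg : RColinear ρ ρ' g) {Y : Type*} [AddCommGroup Y] [Module k Y] (z : V ⊗[k] Y) :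
    TensorProduct.assoc k V' D Y (ρ'.rTensor Y (g.rTensor Y z)) =
      g.rTensor (D ⊗[k] Y) (TensorProduct.assoc k V D Y (ρ.rTensor Y z)) := by
  refine z.induction_on (by simp) (fun a b => ?_)
    (fun _ _ ha hb => by simp only [map_add, ha, hb])
  simp only [LinearMap.rTensor_tmul, hg a]
  generalize ρ a = t
  refine t.induction_on (by simp) (fun a b => ?_)
    (fun _ _ ha hb => by simp only [map_add, add_tmul, ha, hb])
  simp

theorem RColinear.zero (ρ : V →ₗ[k] V ⊗[k] D) (ρ' : V' →ₗ[k] V' ⊗[k] D) :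
    RColinear ρ ρ' 0 := fun x => by simp

theorem RColinear.sub {ρ : V →ₗ[k] V ⊗[k] D} {ρ' : V' →ₗ[k] V' ⊗[k] D} {g h : V →ₗ[k] V'}
    (hg : RColinear ρ ρ' g) (hh : RColinear ρ ρ' h) : RColinear ρ ρ' (g - h) := fun x => by
  rw [LinearMap.rTensor_sub, LinearMap.sub_apply, LinearMap.sub_apply, map_sub, hg, hh]

theorem RColinear.comp {ρ : V →ₗ[k] V ⊗[k] D} {ρ' : V' →ₗ[k] V' ⊗[k] D}
    {ρ'' : V'' →ₗ[k] V'' ⊗[k] D} {h : V' →ₗ[k] V''} {g : V →ₗ[k] V'}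
    (hh : RColinear ρ' ρ'' h) (hg : RColinear ρ ρ' g) : RColinear ρ ρ'' (h ∘ₗ g) := fun x => by
  rw [LinearMap.comp_apply, hh, hg, LinearMap.rTensor_comp_apply]

/-- The coaction on the kernel of a colinear map. -/
def kerCoact {ρ : V →ₗ[k] V ⊗[k] D} {ρ' : V' →ₗ[k] V' ⊗[k] D} {g : V →ₗ[k] V'}
    (hg : RColinear ρ ρ' g) :
    LinearMap.eqLocus g 0 →ₗ[k] LinearMap.eqLocus g (0 : V →ₗ[k] V') ⊗[k] D :=
  liftR g 0 (ρ ∘ₗ (LinearMap.eqLocus g 0).subtype) (fun x => by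
    have hx : g x = 0 := x.2
    rw [LinearMap.rTensor_zero, LinearMap.comp_apply, ← hg, Submodule.subtype_apply, hx, map_zero,
      LinearMap.zero_apply])

theorem subtype_rColinear {ρ : V →ₗ[k] V ⊗[k] D} {ρ' : V' →ₗ[k] V' ⊗[k] D} {g : V →ₗ[k] V'}
    (hg : RColinear ρ ρ' g) :
    RColinear (kerCoact hg) ρ (LinearMap.eqLocus g 0).subtype := fun x =>
  (liftR_spec g 0 (ρ ∘ₗ (LinearMap.eqLocus g 0).subtype) _ x).symm

variable [Coalgebra k D]

/-- A coaction restricts to a subspace along an injective colinear map. -/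
theorem IsRightCoaction.of_injective {g : V →ₗ[k] V'} {ρ : V →ₗ[k] V ⊗[k] D}
    {ρ' : V' →ₗ[k] V' ⊗[k] D} (h : IsRightCoaction ρ') (hg : RColinear ρ ρ' g)
    (hi : Function.Injective g) : IsRightCoaction ρ where
  coassoc x := by
    apply rTensor_inj _ hi
    rw [← assoc_rTensor_rTensor hg, ← hg, h.coassoc, hg, rl_comm]
  counit x := by
    apply rTensor_inj _ hi
    rw [rl_comm, ← hg, h.counit, LinearMap.rTensor_tmul]

/-- A coaction descends along a surjective colinear map. -/
theorem IsRightCoaction.of_surjective {g : V →ₗ[k] V'} {ρ : V →ₗ[k] V ⊗[k] D}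
    {ρ' : V' →ₗ[k] V' ⊗[k] D} (h : IsRightCoaction ρ) (hg : RColinear ρ ρ' g)
    (hs : Function.Surjective g) : IsRightCoaction ρ' where
  coassoc x := by
    obtain ⟨x, rfl⟩ := hs x
    rw [hg, assoc_rTensor_rTensor hg, h.coassoc, rl_comm]
  counit x := by
    obtain ⟨x, rfl⟩ := hs x
    rw [hg, ← rl_comm, h.counit, LinearMap.rTensor_tmul]

/-- The map `g □_D C`. -/
abbrev cotC.map (f : C →ₗc[k] D) {ρ : V →ₗ[k] V ⊗[k] D} {ρ' : V' →ₗ[k] V' ⊗[k] D}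
    {g : V →ₗ[k] V'} (hg : RColinear ρ ρ' g) :
    Cotensor ρ (lamf f) →ₗ[k] Cotensor ρ' (lamf f) :=
  cotMap g LinearMap.id hg (LColinear.id (lamf f))

theorem cotC.map_comp_apply (f : C →ₗc[k] D) {ρ : V →ₗ[k] V ⊗[k] D} {ρ' : V' →ₗ[k] V' ⊗[k] D}
    {ρ'' : V'' →ₗ[k] V'' ⊗[k] D} {h : V' →ₗ[k] V''} {g : V →ₗ[k] V'}
    (hh : RColinear ρ' ρ'' h) (hg : RColinear ρ ρ' g) (x : Cotensor ρ (lamf f)) :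
    cotC.map f (hh.comp hg) x = cotC.map f hh (cotC.map f hg x) := by
  apply incl_injective
  simp only [coe_cotMap, TensorProduct.map_map, LinearMap.id_comp]

theorem cotC.map_sub_apply (f : C →ₗc[k] D) {ρ : V →ₗ[k] V ⊗[k] D} {ρ' : V' →ₗ[k] V' ⊗[k] D}
    {g h : V →ₗ[k] V'} (hg : RColinear ρ ρ' g) (hh : RColinear ρ ρ' h)
    (x : Cotensor ρ (lamf f)) :
    cotC.map f (hg.sub hh) x = cotC.map f hg x - cotC.map f hh x := by
  apply incl_injective
  rw [map_sub]
  simp only [coe_cotMap]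
  exact LinearMap.congr_fun (LinearMap.rTensor_sub g h) _

theorem cotC.map_id_apply (f : C →ₗc[k] D) {ρ : V →ₗ[k] V ⊗[k] D} (x : Cotensor ρ (lamf f)) :
    cotC.map f (RColinear.id ρ) x = x := by
  apply incl_injective
  simp only [coe_cotMap, TensorProduct.map_id, LinearMap.id_apply]

theorem cotC.map_congr (f : C →ₗc[k] D) {ρ : V →ₗ[k] V ⊗[k] D} {ρ' : V' →ₗ[k] V' ⊗[k] D}
    {g h : V →ₗ[k] V'} (hg : RColinear ρ ρ' g) (hh : RColinear ρ ρ' h) (e : g = h)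
    (x : Cotensor ρ (lamf f)) : cotC.map f hg x = cotC.map f hh x := by
  subst e
  rfl

theorem cotC.map_zero_apply (f : C →ₗc[k] D) {ρ : V →ₗ[k] V ⊗[k] D} {ρ' : V' →ₗ[k] V' ⊗[k] D}
    (x : Cotensor ρ (lamf f)) : cotC.map f (RColinear.zero ρ ρ') x = 0 := by
  apply incl_injective
  rw [map_zero]
  simp only [coe_cotMap]
  exact LinearMap.congr_fun (LinearMap.rTensor_zero C) _

end Comodules

variable [Coalgebra k D]

/-- The kernel of a morphism of right comodules. -/
def RComod.ker {X Y : RComod k D} (g : X ⟶ Y) : RComod k D where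
  carrier := LinearMap.eqLocus g.lin 0
  ρ := kerCoact g.colin
  isCo := X.isCo.of_injective (subtype_rColinear g.colin) (Submodule.injective_subtype _)

/-- The inclusion of the kernel. -/
def RComod.kerι {X Y : RComod k D} (g : X ⟶ Y) : RComod.ker g ⟶ X :=
  ⟨(LinearMap.eqLocus g.lin 0).subtype, subtype_rColinear g.colin⟩

theorem RComod.kerι_injective {X Y : RComod k D} (g : X ⟶ Y) :
    Function.Injective (RComod.kerι g).lin := Submodule.injective_subtype _

theorem RComod.kerι_exact {X Y : RComod k D} (g : X ⟶ Y) :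
    Function.Exact (RComod.kerι g).lin g.lin := fun x =>
  ⟨fun h => ⟨⟨x, h⟩, rfl⟩, by rintro ⟨y, rfl⟩; exact y.2⟩

/-- The factorization through the kernel. -/
def RComod.kerLift {X Y Z : RComod k D} (h : X ⟶ Y) (g : Y ⟶ Z)
    (w : ∀ x, g.lin (h.lin x) = 0) : X ⟶ RComod.ker g where
  lin := LinearMap.codRestrict (LinearMap.eqLocus g.lin 0) h.lin w
  colin x := by
    apply rTensor_inj _ (Submodule.injective_subtype _)
    refine (subtype_rColinear g.colin _).symm.trans ?_
    exact (h.colin x).trans (LinearMap.rTensor_comp_apply D (LinearMap.eqLocus g.lin 0).subtype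
      (LinearMap.codRestrict (LinearMap.eqLocus g.lin 0) h.lin w) (X.ρ x))

/-- The cokernel of a morphism of right comodules. -/
def RComod.coker {X Y : RComod k D} (g : X ⟶ Y) : RComod k D :=
  let q := (LinearMap.range g.lin).mkQ
  let r := (LinearMap.range g.lin).liftQ (q.rTensor D ∘ₗ Y.ρ) (by
    have h : q ∘ₗ g.lin = 0 := LinearMap.range_mkQ_comp g.lin
    rintro _ ⟨x, rfl⟩
    rw [LinearMap.mem_ker, LinearMap.comp_apply, g.colin, ← LinearMap.rTensor_comp_apply, h]
    simp)
  { carrier := Y.carrier ⧸ LinearMap.range g.lin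
    ρ := r
    isCo := Y.isCo.of_surjective (g := q) (fun _ => rfl) (Submodule.mkQ_surjective _) }

/-- The projection onto the cokernel. -/
def RComod.cokerπ {X Y : RComod k D} (g : X ⟶ Y) : Y ⟶ RComod.coker g :=
  ⟨(LinearMap.range g.lin).mkQ, fun _ => rfl⟩

/-- The corestriction of a right `C`-comodule along `f : C → D`. -/
def corestComod (f : C →ₗc[k] D) (V : RComod k C) : RComod k D where
  carrier := V.carrier
  ρ := corestR f V.ρ
  isCo := corestR_isRightCoaction f V.isCo

theorem RComod.isIso_of_bijective {X Y : RComod k C} (g : X ⟶ Y)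
    (hg : Function.Bijective g.lin) : IsIso g := by
  let e := LinearEquiv.ofBijective g.lin hg
  have h1 : g.lin ∘ₗ e.symm.toLinearMap = LinearMap.id := LinearMap.ext e.apply_symm_apply
  have h2 : e.symm.toLinearMap ∘ₗ g.lin = LinearMap.id := LinearMap.ext e.symm_apply_apply
  refine ⟨⟨e.symm.toLinearMap, fun x => ?_⟩, RComod.hom_ext h2, RComod.hom_ext h1⟩
  apply rTensor_inj _ hg.1
  rw [← g.colin, ← LinearMap.rTensor_comp_apply, h1, LinearMap.rTensor_id, LinearMap.id_apply]
  exact congrArg Y.ρ (e.apply_symm_apply x)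

theorem RMod.isIso_of_bijective {A : IntAlg k C} {M N : RMod A} (g : M ⟶ N)
    (hg : Function.Bijective g.hom.lin) : IsIso g := by
  have := RComod.isIso_of_bijective g.hom hg
  have h1 : g.hom.lin ∘ₗ (inv g.hom).lin = LinearMap.id := by
    rw [← RComod.comp_lin, IsIso.inv_hom_id, RComod.id_lin]
  have h2 : (inv g.hom).lin ∘ₗ g.hom.lin = LinearMap.id := by
    rw [← RComod.comp_lin, IsIso.hom_inv_id, RComod.id_lin]
  refine ⟨⟨inv g.hom, fun x => ?_⟩, RMod.hom_ext h2, RMod.hom_ext h1⟩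
  apply hg.1
  rw [g.equivariant, ← LinearMap.comp_apply, h1, LinearMap.id_apply]
  apply congrArg N.act
  apply incl_injective
  simp only [coe_cotMap, TensorProduct.map_map, h1, LinearMap.id_comp, TensorProduct.map_id,
    LinearMap.id_apply]

theorem LComod.IsCoflat.surjective {M : LComod k D} (hM : M.IsCoflat) {X Y : RComod k D}
    (p : X ⟶ Y) (hp : Function.Surjective p.lin) :
    Function.Surjective ((cotVec M).map p).hom :=
  (hM _ _ _ (RComod.kerι p) p (RComod.kerι_injective p) (RComod.kerι_exact p) hp).2.2

theorem LComod.IsCoflat.exact {M : LComod k D} (hM : M.IsCoflat) {X Y Z : RComod k D}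
    (g : X ⟶ Y) (p : Y ⟶ Z) (h : Function.Exact g.lin p.lin) (hp : Function.Surjective p.lin) :
    Function.Exact ((cotVec M).map g).hom ((cotVec M).map p).hom := by
  let g' := RComod.kerLift g p h.apply_apply_eq_zero
  have hg' : Function.Surjective g'.lin := by
    rintro ⟨y, hy⟩
    obtain ⟨x, hx⟩ := (h y).1 hy
    exact ⟨x, Subtype.ext hx⟩
  have e : g' ≫ RComod.kerι p = g := RComod.hom_ext (LinearMap.ext fun _ => rfl)
  have hs := hM.surjective g' hg'
  have hx := (hM _ _ _ _ p (RComod.kerι_injective p) (RComod.kerι_exact p) hp).2.1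
  intro y
  rw [hx y, ← e, Functor.map_comp]
  constructor
  · rintro ⟨z, rfl⟩
    obtain ⟨x, rfl⟩ := hs z
    exact ⟨x, rfl⟩
  · rintro ⟨x, rfl⟩
    exact ⟨_, rfl⟩

section Descent

variable (f : C →ₗc[k] D)

theorem actD_unitMap (N : RMod (selfAlg f)) (n : N.V.carrier) :
    actD f N (unitMap f N.V.ρ N.V.isCo n) = n := by
  have h := N.act_one (toCot N.V.ρ N.V.isCo n)
  refine Eq.trans (congrArg N.act ?_) (h.trans (N.V.isCo.rEps n))
  apply incl_injective
  apply lTensor_inj _ (incl_injective (rhof f) (lamf f))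
  refine (expand_spec f N.V.ρ N.V.isCo _).trans ?_
  rw [unitMap_spec, N.V.isCo.coassoc]
  change _ = (incl (rhof f) (lamf f)).lTensor _ ((selfUnit f).lTensor _ (N.V.ρ n))
  rw [← LinearMap.lTensor_comp_apply]
  rfl

theorem cotC_isRightCoaction {W : Type v} [AddCommGroup W] [Module k W] (ρ : W →ₗ[k] W ⊗[k] D) :
    IsRightCoaction (cotC f ρ) :=
  cotR_isRightCoaction _ _ _ _ comul_isRightCoaction

theorem unitMap_actD (N : RMod (selfAlg f)) (y : Cotensor (corestR f N.V.ρ) (lamf f)) :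
    unitMap f N.V.ρ N.V.isCo (actD f N y) =
      cotC.map f ((actD_rColinear f N).corestR f)
        (unitMap f (cotC f (corestR f N.V.ρ)) (cotC_isRightCoaction f _) y) := by
  apply incl_injective
  rw [unitMap_spec, actD_rColinear, coe_cotMap]
  rfl

theorem map_epsD_unitMap (N : RMod (selfAlg f)) (y : Cotensor (corestR f N.V.ρ) (lamf f)) :
    cotC.map f (epsD_rColinear f N)
      (unitMap f (cotC f (corestR f N.V.ρ)) (cotC_isRightCoaction f _) y) = y := by
  apply incl_injective
  change (rEps _ ∘ₗ incl _ _).rTensor C (cotC f (corestR f N.V.ρ) y) = _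
  rw [LinearMap.rTensor_comp_apply, cotR_spec, rEps_comul]

theorem lEps_expand {V : Type v} [AddCommGroup V] [Module k V] (ρ : V →ₗ[k] V ⊗[k] C)
    (hρ : IsRightCoaction ρ) (x : Cotensor (corestR f ρ) (lamf f)) :
    (lEps C ∘ₗ incl (rhof f) (lamf f)).lTensor V (incl _ _ (expand f ρ hρ x)) = incl _ _ x := by
  rw [LinearMap.lTensor_comp_apply, expand_spec]
  generalize incl (corestR f ρ) (lamf f) x = z
  refine z.induction_on (by simp) (fun a b => ?_)
    (fun _ _ ha hb => by simp only [map_add, ha, hb])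
  rw [LinearMap.rTensor_tmul]
  conv_rhs => rw [← hρ.rEps a]
  generalize ρ a = t
  refine t.induction_on (by simp) (fun a b => ?_)
    (fun _ _ ha hb => by simp only [map_add, add_tmul, ha, hb])
  simp [smul_tmul]

theorem expand_natural {V V' : Type v} [AddCommGroup V] [Module k V] [AddCommGroup V']
    [Module k V'] {ρ : V →ₗ[k] V ⊗[k] C} (hρ : IsRightCoaction ρ) {ρ' : V' →ₗ[k] V' ⊗[k] C}
    (hρ' : IsRightCoaction ρ') {g : V →ₗ[k] V'} (hg : RColinear ρ ρ' g)
    (x : Cotensor (corestR f ρ) (lamf f)) :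
    cotMap g LinearMap.id hg (LColinear.id _) (expand f ρ hρ x) =
      expand f ρ' hρ' (cotC.map f (hg.corestR f) x) := by
  apply incl_injective
  apply lTensor_inj _ (incl_injective (rhof f) (lamf f))
  rw [expand_spec, coe_cotMap, coe_cotMap]
  change (incl (rhof f) (lamf f)).lTensor V' (g.rTensor _ _) =
    TensorProduct.assoc k _ _ _ (ρ'.rTensor C (g.rTensor C _))
  rw [← rl_comm, expand_spec, assoc_rTensor_rTensor hg]

theorem actD_assoc (N : RMod (selfAlg f))
    (w : Cotensor (corestR f (cotC f (corestR f N.V.ρ))) (lamf f)) :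
    actD f N (cotC.map f ((actD_rColinear f N).corestR f) w) =
      actD f N (cotC.map f (epsD_rColinear f N) w) := by
  have hco : IsRightCoaction (cotR N.V.ρ (selfL f) (cotC f (rhof f)) (self_commutes f)) :=
    cotR_isRightCoaction _ _ _ _ (selfAlg f).A.isCoR
  have hex := expand_rColinear f N.V.ρ N.V.isCo
  let x := expand f _ hco (cotC.map f (hex.corestR f) w)
  have h := N.act_assoc x
  have h1 : actD f N (cotC.map f ((actD_rColinear f N).corestR f) w) =
      N.act (cotMap N.act LinearMap.id N.act_colin (LColinear.id _) x) := by
    refine congrArg N.act ?_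
    refine Eq.trans ?_ (expand_natural f hco N.V.isCo N.act_colin
      (cotC.map f (hex.corestR f) w)).symm
    refine congrArg (expand f N.V.ρ N.V.isCo) ?_
    exact cotC.map_comp_apply f (RColinear.corestR f N.act_colin) (hex.corestR f) w
  refine h1.trans (h.trans (congrArg N.act ?_))
  apply incl_injective
  apply lTensor_inj _ (incl_injective (rhof f) (lamf f))
  refine Eq.trans ?_ (expand_spec f N.V.ρ N.V.isCo _).symm
  rw [coe_cotMap, coe_cotMap]
  change (incl (rhof f) (lamf f)).lTensor _ ((cotAct f (rhof f)).lTensor _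
    (incl _ _ (cotAssoc N.V.ρ (selfL f) (cotC f (rhof f)) (self_commutes f) (selfL f) x))) = _
  have e1 : incl (rhof f) (lamf f) ∘ₗ cotAct f (rhof f) =
      TensorProduct.map (rEps C ∘ₗ incl (rhof f) (lamf f))
        (lEps C ∘ₗ incl (rhof f) (lamf f)) ∘ₗ incl (cotC f (rhof f)) (selfL f) := rfl
  rw [← LinearMap.lTensor_comp_apply, e1, LinearMap.lTensor_comp_apply, cotAssoc_spec]
  have e2 : ∀ z : Cotensor N.V.ρ (selfL f) ⊗[k] Cotensor (rhof f) (lamf f),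
      (TensorProduct.map (rEps C ∘ₗ incl (rhof f) (lamf f))
        (lEps C ∘ₗ incl (rhof f) (lamf f))).lTensor N.V.carrier
        (TensorProduct.assoc k _ _ _ ((incl N.V.ρ (selfL f)).rTensor _ z)) =
      TensorProduct.assoc k _ _ _ (((rEps C ∘ₗ incl (rhof f) (lamf f)).lTensor N.V.carrier ∘ₗ
        incl N.V.ρ (selfL f)).rTensor C
          ((lEps C ∘ₗ incl (rhof f) (lamf f)).lTensor _ z)) := by
    intro z
    refine z.induction_on (by simp) (fun a b => ?_)
      (fun _ _ ha hb => by simp only [map_add, ha, hb])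
    simp only [LinearMap.rTensor_tmul, LinearMap.lTensor_tmul, LinearMap.comp_apply]
    generalize incl N.V.ρ (selfL f) a = t
    refine t.induction_on (by simp) (fun a b => ?_)
      (fun _ _ ha hb => by simp only [map_add, add_tmul, ha, hb])
    simp
  have e3 : ((rEps C ∘ₗ incl (rhof f) (lamf f)).lTensor N.V.carrier ∘ₗ
        incl N.V.ρ (selfL f)) ∘ₗ expand f N.V.ρ N.V.isCo = N.V.ρ ∘ₗ epsD f N := by
    apply LinearMap.ext
    intro y
    simp only [LinearMap.comp_apply]
    rw [LinearMap.lTensor_comp_apply, expand_spec]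
    change _ = N.V.ρ (rEps _ (incl _ _ y))
    generalize incl (corestR f N.V.ρ) (lamf f) y = z
    refine z.induction_on (by simp) (fun a b => ?_)
      (fun _ _ ha hb => by simp only [map_add, ha, hb])
    rw [LinearMap.rTensor_tmul, rEps_tmul, map_smul]
    generalize N.V.ρ a = t
    refine t.induction_on (by simp) (fun a b => ?_)
      (fun _ _ ha hb => by simp only [map_add, add_tmul, smul_add, ha, hb])
    simp
  rw [e2, lEps_expand, coe_cotMap]
  change TensorProduct.assoc k _ _ _ (LinearMap.rTensor C _ ((expand f _ _).rTensor C _)) =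
    TensorProduct.assoc k _ _ _ (N.V.ρ.rTensor C ((epsD f N).rTensor C _))
  rw [← LinearMap.rTensor_comp_apply, ← LinearMap.rTensor_comp_apply, e3]

/-- If `- □_D C` preserves the coequalizer of `actD` and `epsD`, then the unit of the descent
adjunction is bijective. -/
theorem adjUnitLin_bijective (N : RMod (selfAlg f))
    (hs : Function.Surjective (cotC.map f (toCoinv_rColinear f N)))
    (he : ∀ y, cotC.map f (toCoinv_rColinear f N) y = 0 → ∃ w, cotC.map f
      (((actD_rColinear f N).corestR f).sub (epsD_rColinear f N)) w = y) :
    Function.Bijective (adjUnitLin f N) := by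
  constructor
  · rw [injective_iff_map_eq_zero]
    intro n hn
    obtain ⟨w, hw⟩ := he (unitMap f N.V.ρ N.V.isCo n) hn
    rw [← actD_unitMap f N n, ← hw,
      cotC.map_sub_apply f ((actD_rColinear f N).corestR f) (epsD_rColinear f N), map_sub, actD_assoc, sub_self]
  · intro z
    obtain ⟨y, rfl⟩ := hs z
    refine ⟨actD f N y, ?_⟩
    change cotC.map f (toCoinv_rColinear f N) (unitMap f N.V.ρ N.V.isCo (actD f N y)) = _
    rw [unitMap_actD, ← cotC.map_comp_apply]
    conv_rhs => rw [← map_epsD_unitMap f N y, ← cotC.map_comp_apply]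
    exact cotC.map_congr f _ _ (LinearMap.ext (toCoinv_eq f N)) _

/-- If `- □_D C` is faithful and the unit of the descent adjunction is bijective, then so is the
counit. -/
theorem adjCounitLin_bijective
    (hf : ∀ (X Y : RComod k D) (g : X ⟶ Y), (∀ x, cotC.map f g.colin x = 0) → g.lin = 0)
    (W : RComod k D) (hu : Function.Bijective (adjUnitLin f (cotMod f W))) :
    Function.Bijective (adjCounitLin f W) := by
  let g : coinvComod f (cotMod f W) ⟶ W := (descentAdj f).counit.app W
  have hg : g.lin = adjCounitLin f W := rfl
  have ht : ∀ y, cotC.map f g.colin (adjUnitLin f (cotMod f W) y) = y := fun y =>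
    LinearMap.congr_fun (congrArg (fun h => h.hom.lin)
      ((descentAdj f).right_triangle_components W)) y
  have hG : Function.Bijective (cotC.map f g.colin) := by
    constructor
    · intro x y hxy
      obtain ⟨x, rfl⟩ := hu.2 x
      obtain ⟨y, rfl⟩ := hu.2 y
      rw [ht, ht] at hxy
      rw [hxy]
    · exact fun y => ⟨_, ht y⟩
  rw [← hg]
  constructor
  · have h : (RComod.kerι g).lin = 0 := by
      refine hf _ _ _ fun x => hG.1 ?_
      rw [map_zero, ← cotC.map_comp_apply]
      refine (cotC.map_congr f _ (RColinear.zero _ _) ?_ x).trans (cotC.map_zero_apply f x)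
      exact (RComod.kerι_exact g).linearMap_comp_eq_zero
    refine (injective_iff_map_eq_zero g.lin).2 fun x hx => ?_
    exact LinearMap.congr_fun h (⟨x, hx⟩ : LinearMap.eqLocus g.lin 0)
  · have h : (RComod.cokerπ g).lin = 0 := by
      refine hf _ _ _ fun x => ?_
      obtain ⟨x, rfl⟩ := hG.2 x
      rw [← cotC.map_comp_apply]
      refine (cotC.map_congr f _ (RColinear.zero _ _) ?_ x).trans (cotC.map_zero_apply f x)
      exact LinearMap.range_mkQ_comp g.lin
    intro y
    exact (Submodule.Quotient.mk_eq_zero (LinearMap.range g.lin)).1 (LinearMap.congr_fun h y)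

/-- If `- □_D C` is faithful and preserves the coequalizers that define the coinvariants, then the
descent adjunction is an equivalence. -/
theorem isIso_unit_and_counit
    (hf : ∀ (X Y : RComod k D) (g : X ⟶ Y), (∀ x, cotC.map f g.colin x = 0) → g.lin = 0)
    (hs : ∀ N : RMod (selfAlg f), Function.Surjective (cotC.map f (toCoinv_rColinear f N)))
    (he : ∀ (N : RMod (selfAlg f)) y, cotC.map f (toCoinv_rColinear f N) y = 0 → ∃ w, cotC.map f
      (((actD_rColinear f N).corestR f).sub (epsD_rColinear f N)) w = y) :
    IsIso (descentAdj f).unit ∧ IsIso (descentAdj f).counit := by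
  have hu : ∀ N, Function.Bijective (adjUnitLin f N) := fun N =>
    adjUnitLin_bijective f N (hs N) (he N)
  rw [NatTrans.isIso_iff_isIso_app, NatTrans.isIso_iff_isIso_app]
  exact ⟨fun N => RMod.isIso_of_bijective _ (hu N), fun W => RComod.isIso_of_bijective _
    (adjCounitLin_bijective f hf W (hu (cotMod f W)))⟩

/-- The coinvariants are the cokernel of the difference of `actD` and `epsD`. -/
theorem toCoinv_exact (N : RMod (selfAlg f)) :
    Function.Exact (actD f N - epsD f N) (toCoinv f N) :=
  LinearMap.exact_iff.2 (Submodule.ker_mkQ _)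

theorem isIso_of_leftFaithfullyCoflat (hf : LeftFaithfullyCoflat f) :
    IsIso (descentAdj f).unit ∧ IsIso (descentAdj f).counit := by
  obtain ⟨hc, hF⟩ := hf
  let q (N : RMod (selfAlg f)) : corestComod f N.V ⟶ coinvComod f N :=
    ⟨toCoinv f N, toCoinv_rColinear f N⟩
  let d (N : RMod (selfAlg f)) :
      corestComod f (cotComod f (corestComod f N.V)) ⟶ corestComod f N.V :=
    ⟨actD f N - epsD f N, ((actD_rColinear f N).corestR f).sub (epsD_rColinear f N)⟩
  refine isIso_unit_and_counit f (fun X Y g hg => ?_)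
    (fun N => hc.surjective (q N) (Submodule.mkQ_surjective _))
    (fun N y hy => (hc.exact (d N) (q N) (toCoinv_exact f N) (Submodule.mkQ_surjective _) y).1 hy)
  let z : X ⟶ Y := ⟨0, RColinear.zero _ _⟩
  have h : (cotVec (leftComodOf f)).map g = (cotVec (leftComodOf f)).map z :=
    ModuleCat.hom_ext (LinearMap.ext fun x => (hg x).trans (cotC.map_zero_apply f x).symm)
  exact congrArg RComod.Hom.lin (hF.map_injective h)

section Split

variable {s : D →ₗ[k] C} (hl : LColinear Coalgebra.comul (lamf f) s)

/-- A left colinear map `s : D → C` induces a map `W ≅ W □_D D → W □_D C`. -/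
def cotSection {W : Type v} [AddCommGroup W] [Module k W] {ρ : W →ₗ[k] W ⊗[k] D}
    (hρ : IsRightCoaction ρ) : W →ₗ[k] Cotensor ρ (lamf f) :=
  intoCot ρ (lamf f) (s.lTensor W ∘ₗ ρ) (fun x => by
    have e : lamf f ∘ₗ s = s.lTensor D ∘ₗ Coalgebra.comul (R := k) (A := D) := LinearMap.ext hl
    rw [LinearMap.comp_apply, rl_comm, ← LinearMap.lTensor_comp_apply, e,
      LinearMap.lTensor_comp_apply, ← hρ.coassoc]
    generalize ρ.rTensor D (ρ x) = t
    induction t with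
    | zero => simp
    | add a b ha hb => simp only [map_add, ha, hb]
    | tmul a b =>
      refine a.induction_on (by simp) (fun a c => ?_)
        (fun _ _ ha hb => by simp only [map_add, add_tmul, ha, hb])
      simp)

theorem cotSection_natural {V W : Type v} [AddCommGroup V] [Module k V] [AddCommGroup W]
    [Module k W] {ρ : V →ₗ[k] V ⊗[k] D} (hρ : IsRightCoaction ρ) {ρ' : W →ₗ[k] W ⊗[k] D}
    (hρ' : IsRightCoaction ρ') {g : V →ₗ[k] W} (hg : RColinear ρ ρ' g) (x : V) :
    cotSection f hl hρ' (g x) = cotC.map f hg (cotSection f hl hρ x) := by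
  apply incl_injective
  change s.lTensor W (ρ' (g x)) = g.rTensor C (s.lTensor V (ρ x))
  rw [hg, rl_comm]

theorem cotSection_rColinear (hr : RColinear Coalgebra.comul (rhof f) s) {W : Type v}
    [AddCommGroup W] [Module k W] {ρ : W →ₗ[k] W ⊗[k] D} (hρ : IsRightCoaction ρ) :
    RColinear ρ (corestR f (cotC f ρ)) (cotSection f hl hρ) := by
  intro x
  apply rTensor_inj _ (incl_injective _ _)
  have e : rhof f ∘ₗ s = s.rTensor D ∘ₗ Coalgebra.comul (R := k) (A := D) := LinearMap.ext hr
  have e1 : ∀ z : W ⊗[k] C, (f : C →ₗ[k] D).lTensor _ ((TensorProduct.assoc k W C C).symm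
      ((Coalgebra.comul (R := k) (A := C)).lTensor W z)) =
      (TensorProduct.assoc k W C D).symm ((rhof f).lTensor W z) := by
    intro z
    refine z.induction_on (by simp) (fun a b => ?_)
      (fun _ _ ha hb => by simp only [map_add, ha, hb])
    simp only [LinearMap.lTensor_tmul, rhof, corestR, LinearMap.comp_apply]
    generalize Coalgebra.comul (R := k) b = t
    refine t.induction_on (by simp) (fun a b => ?_)
      (fun _ _ ha hb => by simp only [map_add, tmul_add, ha, hb])
    simp
  rw [corestR, LinearMap.comp_apply, rl_comm, cotR_spec, e1, ← LinearMap.rTensor_comp_apply]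
  change (TensorProduct.assoc k W C D).symm ((rhof f).lTensor W (s.lTensor W (ρ x))) =
    (s.lTensor W ∘ₗ ρ).rTensor D (ρ x)
  rw [← LinearMap.lTensor_comp_apply, e, LinearMap.lTensor_comp_apply, ← hρ.coassoc,
    LinearMap.rTensor_comp_apply]
  generalize ρ.rTensor D (ρ x) = t
  induction t with
  | zero => simp
  | add a b ha hb => simp only [map_add, ha, hb]
  | tmul a b =>
    refine a.induction_on (by simp) (fun a c => ?_)
      (fun _ _ ha hb => by simp only [map_add, add_tmul, ha, hb])
    simp

theorem rEps_cotSection (hs : (f : C →ₗ[k] D) ∘ₗ s = LinearMap.id) {W : Type v}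
    [AddCommGroup W] [Module k W] {ρ : W →ₗ[k] W ⊗[k] D} (hρ : IsRightCoaction ρ) (x : W) :
    rEps W (incl ρ (lamf f) (cotSection f hl hρ x)) = x := by
  have e : (Coalgebra.counit (R := k) (A := C)) ∘ₗ s = Coalgebra.counit (R := k) (A := D) := by
    rw [← f.counit_comp, LinearMap.comp_assoc]
    exact (congrArg _ hs).trans (LinearMap.comp_id _)
  change rEps W (s.lTensor W (ρ x)) = x
  conv_rhs => rw [← hρ.rEps x]
  simp only [rEps, LinearMap.comp_apply, ← LinearMap.lTensor_comp_apply, e]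

end Split

theorem isIso_of_splitsInBicomodules (hf : SplitsInBicomodules f) :
    IsIso (descentAdj f).unit ∧ IsIso (descentAdj f).counit := by
  obtain ⟨s, hl, hr, hs⟩ := hf
  have hco (N : RMod (selfAlg f)) : IsRightCoaction (corestR f N.V.ρ) :=
    corestR_isRightCoaction f N.V.isCo
  let σ (N : RMod (selfAlg f)) : N.V.carrier →ₗ[k] Cotensor (corestR f N.V.ρ) (lamf f) :=
    cotSection f hl (hco N)
  have hσ (N : RMod (selfAlg f)) :
      RColinear (corestR f N.V.ρ) (corestR f (cotC f (corestR f N.V.ρ))) (σ N) :=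
    cotSection_rColinear f hl hr (hco N)
  have hεσ (N : RMod (selfAlg f)) (n : N.V.carrier) : epsD f N (σ N n) = n :=
    rEps_cotSection f hl hs (hco N) n
  -- `σ` contracts the pair `actD`, `epsD`
  have hcontr (N : RMod (selfAlg f)) (y : Cotensor (corestR f N.V.ρ) (lamf f)) :
      actD f N (σ N (actD f N y)) = actD f N (σ N (epsD f N y)) := by
    have h := corestR_isRightCoaction f (cotC_isRightCoaction f (corestR f N.V.ρ))
    rw [show σ N (actD f N y) = _ from
      cotSection_natural f hl h (hco N) ((actD_rColinear f N).corestR f) y,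
      show σ N (epsD f N y) = _ from cotSection_natural f hl h (hco N) (epsD_rColinear f N) y,
      actD_assoc]
  let j (N : RMod (selfAlg f)) : CoinvSpace f N →ₗ[k] N.V.carrier :=
    (LinearMap.range (actD f N - epsD f N)).liftQ (actD f N ∘ₗ σ N) (by
      rintro _ ⟨y, rfl⟩
      rw [LinearMap.mem_ker, LinearMap.sub_apply, map_sub, sub_eq_zero]
      exact hcontr N y)
  have hjq (N : RMod (selfAlg f)) : j N ∘ₗ toCoinv f N = actD f N ∘ₗ σ N := rfl
  have hj (N : RMod (selfAlg f)) : RColinear (coinvCoact f N) (corestR f N.V.ρ) (j N) := by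
    intro x
    obtain ⟨n, rfl⟩ := Submodule.mkQ_surjective _ x
    rw [toCoinv_rColinear, ← LinearMap.rTensor_comp_apply, hjq]
    exact ((actD_rColinear f N).corestR f).comp (hσ N) n
  have hqj (N : RMod (selfAlg f)) : toCoinv f N ∘ₗ j N = LinearMap.id := by
    apply LinearMap.ext
    intro x
    obtain ⟨n, rfl⟩ := Submodule.mkQ_surjective _ x
    exact (toCoinv_eq f N (σ N n)).trans (congrArg _ (hεσ N n))
  refine isIso_unit_and_counit f (fun X Y g hg => ?_) (fun N z => ?_) (fun N y hy => ?_)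
  · apply LinearMap.ext
    intro x
    rw [← rEps_cotSection f hl hs Y.isCo (g.lin x), cotSection_natural f hl X.isCo Y.isCo g.colin,
      hg]
    simp
  · refine ⟨cotC.map f (hj N) z, ?_⟩
    rw [← cotC.map_comp_apply]
    exact (cotC.map_congr f _ (RColinear.id _) (hqj N) z).trans (cotC.map_id_apply f z)
  · refine ⟨-cotC.map f (hσ N) y, ?_⟩
    have h1 : cotC.map f ((actD_rColinear f N).corestR f) (cotC.map f (hσ N) y) = 0 := by
      rw [← cotC.map_comp_apply]
      refine (cotC.map_congr f _ ((hj N).comp (toCoinv_rColinear f N)) (hjq N).symm y).trans ?_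
      rw [cotC.map_comp_apply f (hj N) (toCoinv_rColinear f N), hy, map_zero]
    have h2 : cotC.map f (epsD_rColinear f N) (cotC.map f (hσ N) y) = y := by
      rw [← cotC.map_comp_apply]
      exact (cotC.map_congr f _ (RColinear.id _) (LinearMap.ext (hεσ N)) y).trans
        (cotC.map_id_apply f y)
    rw [map_neg, cotC.map_sub_apply f ((actD_rColinear f N).corestR f) (epsD_rColinear f N),
      h1, h2, zero_sub, neg_neg]

end Descent

end

end CoalgDescent

theorem mainTheorem10 {k : Type u} [Field k] {C D : Type v}
    [AddCommGroup C] [Module k C] [Coalgebra k C]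
    [AddCommGroup D] [Module k D] [Coalgebra k D] (f : C →ₗc[k] D)
    (hf : CoalgDescent.LeftFaithfullyCoflat f ∨ CoalgDescent.SplitsInBicomodules f) :
    IsIso (CoalgDescent.descentAdj f).unit ∧ IsIso (CoalgDescent.descentAdj f).counit :=
  hf.elim (CoalgDescent.isIso_of_leftFaithfullyCoflat f)
    (CoalgDescent.isIso_of_splitsInBicomodules f)
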